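/- **Setup.** Let $\lambda>0$, let $F$ be the cumulative distribution function of a real random variable $X$ with $E[X_+]<\infty$, and let $X_0$ be a real random variable with $E|X_0|<\infty$. Put $\mu_0=E[X_0]$ and $M=\sup\{x : F(x)<1\}\in(-\infty,+\infty]$, and assume $0\le\mu_0<M$. An asset must be sold within a time $t\ge 0$. Offers $X_1,X_2,\dots$ (i.i.d. with distribution $F$) arrive as a Poisson process of rate $\lambda$: the times $D_1,D_2,\dots$ between consecutive offers are i.i.d. exponential with rate $\lambda$, and the $D_i$, the $X_i$ and $X_0$ are all independent. The time remaining when the $i$-th offer arrives is $t_i=\max(t_{i-1}-D_i,0)$, with $t_0=t$. On the arrival of each offer the seller either accepts it, which ends the process, or rejects it for good. A policy is a rule that decides on the $i$-th offer from $(D_1,X_1),\dots,(D_i,X_i)$. The realized sale price is $X_i$ if the $i$-th offer is accepted and $t_i>0$; if no offer is accepted before the deadline, it is $X_0$. Policies are compared by their expected sale price (which is well defined in $[-\infty,\infty)$ for every policy). For $t>0$ let $V(t,x)$ be the maximum expected sale price that can be achieved when an offer $x$ arrives with $t$ time units left: the seller either takes $x$, or rejects it and follows some policy for the offers arriving in the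 remaining time $t$. Let $V(0,x)=\mu_0$. For $t\ge0$ let $$\mu(t)=E\big[V((t-D)_+,X)\big],$$ where $D$ is exponential with rate $\lambda$, $X$ has distribution $F$, and $D$, $X$ are independent. Finally let $$\phi(x)=\int_x^\infty (1-F(u))\,du .$$ **Theorem.** 1. The maximum defining $V(t,x)$ is attained, the expectation defining $\mu(t)$ exists, and $V(t,x)=\max(x,\mu(t))$ for all $t>0$ and $x\in\mathbb R$. For every $t\ge0$, the policy with threshold $\mu$, which accepts the first offer $x$ with $x\ge\mu(s)$, where $s$ is the time remaining when it arrives, has the greatest expected sale price among all policies for the marketing period $t$, and this greatest expected sale price is $\mu(t)$. 2. $\phi(x)=E[(X-x)_+]<\infty$ for all $x\in\mathbb R$, and $\mu$ is the unique solution on $[0,\infty)$ (with one-sided derivative at $0$) of the initial value problem $$\mu'(t)=\lambda\,\phi(\mu(t)),\qquad \mu(0)=\mu_0 .$$ 3. $\phi>0$ on $[\mu_0,M)$, the function $\Psi(x)=\int_{\mu_0}^x \frac{du}{\phi(u)}$ is well defined on $[\mu_0,M)$ and maps $[\mu_0,M)$ bijectively onto $[0,\infty)$, and with $\Psi^{-1}:[0,\infty)\to[\mu_0,M)$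 its inverse, $$\mu(t)=\Psi^{-1}(\lambda t)\qquad\text{for all } t\ge 0 .$$ -/

import Mathlib

open MeasureTheory ProbabilityTheory Set

namespace CayleyMoser

noncomputable section

/-- The mean salvage value `μ₀ = E[X₀]` for the residual price distribution `ν₀`. -/
def meanSalvage (ν₀ : Measure ℝ) : ℝ := ∫ x, x ∂ν₀

/-- `M = sup {x | F x < 1}`, possibly `+∞`, where `F` is the CDF of the offer distribution `ν`. -/
def maxOffer (ν : Measure ℝ) : EReal := sSup ((fun x : ℝ => (x : EReal)) '' {x : ℝ | cdf ν x < 1})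

/-- `φ x = ∫_x^∞ (1 - F u) du`, where `F` is the CDF of the offer distribution `ν`. -/
def phi (ν : Measure ℝ) (x : ℝ) : ℝ := ∫ u in Ioi x, (1 - cdf ν u)

/-- `Ψ x = ∫_{μ₀}^x du / φ u`. -/
def psi (ν ν₀ : Measure ℝ) (x : ℝ) : ℝ := ∫ u in (meanSalvage ν₀)..x, 1 / phi ν u

/-- The interval `[μ₀, M)`. -/
def priceRange (ν ν₀ : Measure ℝ) : Set ℝ := {x : ℝ | meanSalvage ν₀ ≤ x ∧ (x : EReal) < maxOffer ν}

/-- The random input of the bidding process with Poisson arrivals of rate `r`: independent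
exponential waiting times between consecutive offers, i.i.d. offers with law `ν`, and a salvage
value with law `ν₀`, all of them jointly independent. Offers are numbered from `0`, and `wait i`
is the time between offer `i - 1` (the start, if `i = 0`) and offer `i`. -/
structure BiddingProcess {Ω : Type*} [MeasurableSpace Ω] (P : Measure Ω) (r : ℝ)
    (ν ν₀ : Measure ℝ) where
  wait : ℕ → Ω → ℝ
  offer : ℕ → Ω → ℝ
  salvage : Ω → ℝ
  measurable_wait : ∀ i, Measurable (wait i)
  measurable_offer : ∀ i, Measurable (offer i)
  measurable_salvage : Measurable salvage
  hasLaw_wait : ∀ i, HasLaw (wait i) (expMeasure r) P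
  hasLaw_offer : ∀ i, HasLaw (offer i) ν P
  hasLaw_salvage : HasLaw salvage ν₀ P
  indepFun_wait_offer : ∀ i, IndepFun (wait i) (offer i) P
  iIndepFun_arrivals : iIndepFun (fun i ω => (wait i ω, offer i ω)) P
  indepFun_salvage : IndepFun salvage (fun ω (i : ℕ) => (wait i ω, offer i ω)) P

namespace BiddingProcess

variable {Ω : Type*} [MeasurableSpace Ω] {P : Measure Ω} {r : ℝ} {ν ν₀ : Measure ℝ}

/-- The time remaining to the deadline after `n` arrivals, when it is `t` at the start:
`t₀ = t` and `t_{n+1} = (t_n - D_{n+1})₊`. So offer `n` (numbered from `0`) arrives with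
`remaining t (n + 1)` time units left, and not before the deadline if this is `0`. -/
def remaining (B : BiddingProcess P r ν ν₀) (t : ℝ) : ℕ → Ω → ℝ
  | 0, _ => t
  | n + 1, ω => max (B.remaining t n ω - B.wait n ω) 0

/-- The information available to the seller when offer `n` arrives: the arrival times and the
values of the offers up to and including offer `n`. -/
def history (B : BiddingProcess P r ν ν₀) : Filtration ℕ (inferInstance : MeasurableSpace Ω) :=
  Filtration.natural (fun i ω => (B.wait i ω, B.offer i ω))
    (fun i => ((B.measurable_wait i).prodMk (B.measurable_offer i)).stronglyMeasurable)

/-- A selling policy: `τ` is the number of the offer to be accepted (`⊤` for none), and the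
decision on each offer depends only on the history up to that offer. Rules that look only at the
value of the offer and the remaining time are a special case. -/
def IsPolicy (B : BiddingProcess P r ν ν₀) (τ : Ω → WithTop ℕ) : Prop :=
  IsStoppingTime B.history τ

open Classical in
/-- The realized sale price under `τ`, with marketing period `t`: the value of the accepted offer
if it arrives before the deadline, and the salvage value otherwise. -/
def salePrice (B : BiddingProcess P r ν ν₀) (t : ℝ) (τ : Ω → WithTop ℕ) (ω : Ω) : ℝ :=
  if h : ∃ n : ℕ, τ ω = (n : WithTop ℕ) ∧ 0 < B.remaining t (n + 1) ω then
    B.offer h.choose ω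
  else B.salvage ω

/-- The expected sale prices that policies can achieve with marketing period `t` (a policy whose
sale price is not integrable has no finite expected price). -/
def achievable (B : BiddingProcess P r ν ν₀) (t : ℝ) : Set ℝ :=
  {v : ℝ | ∃ τ : Ω → WithTop ℕ, B.IsPolicy τ ∧ Integrable (B.salePrice t τ) P ∧
    ∫ ω, B.salePrice t τ ω ∂P = v}

open Classical in
/-- The value function `V(t, x)`: the best expected price when an offer `x` arrives with `t` time
units left. Before the deadline the seller may take `x`, or reject it and follow any policy from
then on; at the deadline the asset goes for the salvage value, whose mean is `μ₀`. -/
def value (B : BiddingProcess P r ν ν₀) (t x : ℝ) : ℝ :=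
  if 0 < t then sSup (insert x (B.achievable t)) else meanSalvage ν₀

/-- The expected value of rejecting an offer with `t` time units left:
`μ(t) = E[V((t - D)₊, X)]`, where `D` is exponential with rate `r`, `X` has law `ν`, and they are
independent. -/
def optimalThreshold (B : BiddingProcess P r ν ν₀) (t : ℝ) : ℝ :=
  ∫ z : ℝ × ℝ, B.value (max (t - z.1) 0) z.2 ∂((expMeasure r).prod ν)

open Classical in
/-- The policy with threshold function `m`, with marketing period `t`: accept the first offer that
is at least `m s`, where `s` is the time remaining when it arrives. -/
def thresholdPolicy (B : BiddingProcess P r ν ν₀) (m : ℝ → ℝ) (t : ℝ) (ω : Ω) : WithTop ℕ :=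
  if h : ∃ n : ℕ, m (B.remaining t (n + 1) ω) ≤ B.offer n ω then
    ((Nat.find h : ℕ) : WithTop ℕ)
  else ⊤

end BiddingProcess

end

end CayleyMoser

/-!
Rejecting an offer with `t` time units left is worth `m t`, where `m` solves `m' = r φ(m)`,
`m 0 = μ₀`. The proof constructs `m` first and then verifies that it is the value of the selling
problem.

*The equation.* By the layer-cake formula `φ x = E[(X - x)₊]`. Hence `φ` is antitone and
`1`-Lipschitz, tends to `0` at infinity, and is positive exactly below `M`. The Lipschitz bound
yields `Ψ x ≥ log (φ μ₀ / φ x)` (`log_le_recipPrimitive`), so `Ψ` maps `[μ₀, M)` onto `[0, ∞)`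
(`bijOn_recipPrimitive`). The solution is `m t = Ψ⁻¹(r t)` (`flow`), and it is unique because `φ` is
Lipschitz.

*The Bellman equation.* Since `E[max (X, c)] = c + φ c`, the equation for `m` says that
`- e^{-r u} m(t - u)` has the derivative `r e^{-r u} E[max (X, m(t - u))]` in `u`. Integration over
`[0, t]` gives `m t = E[v((t - D)₊, X)]`, where `v(s, x)` is `max (x, m s)` for `s > 0` and `μ₀` for
`s = 0` (`bellman`).

*Verification.* The salvage value is independent of the arrivals, so in expectation it may be
replaced by `μ₀` (`salvage_correction`). For a policy `τ` consider, just before offer `n`, the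
`position`: `m` at the remaining time if the asset is unsold, and otherwise the positive part of the
price. The next arrival is independent of the past, so by the Bellman equation the position is a
nonnegative supermartingale with initial value `m t`, and a martingale for the threshold policy.
Chernoff's bound shows that almost surely only finitely many offers arrive before the deadline, so
the position is eventually the positive part of the price. Fatou's lemma then bounds the expected
positive part of the price by `m t` for every policy, without any integrability assumption. For the
threshold policy the price is nonnegative, because `μ₀ ≥ 0`, and dominated convergence gives
equality.
-/

namespace CayleyMoser

open Filter Topology

/-! ### The function `φ` -/

section Phi

variable {ν : Measure ℝ} [IsProbabilityMeasure ν]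

lemma integrable_sub_posPart (hν : Integrable (fun x : ℝ => max x 0) ν) (x : ℝ) :
    Integrable (fun u : ℝ => max (u - x) 0) ν := by
  refine (hν.add (integrable_const |x|)).mono' (by fun_prop) (ae_of_all _ fun u => ?_)
  rw [Real.norm_of_nonneg (le_max_right _ _)]
  refine max_le ?_ (add_nonneg (le_max_right _ _) (abs_nonneg x))
  show u - x ≤ max u 0 + |x|
  linarith [le_max_left u 0, neg_abs_le x]

omit [IsProbabilityMeasure ν] in
lemma setOf_lt_sub_posPart {x t : ℝ} (ht : 0 < t) :
    {u : ℝ | t < max (u - x) 0} = Ioi (t + x) := by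
  ext u
  simp only [mem_ofPred_eq, lt_max_iff, mem_Ioi, lt_sub_iff_add_lt, or_iff_left ht.not_gt]

lemma measureReal_Ioi_eq_one_sub_cdf (x : ℝ) : ν.real (Ioi x) = 1 - cdf ν x := by
  rw [cdf_eq_real, ← compl_Iic, probReal_compl_eq_one_sub measurableSet_Iic]

omit [IsProbabilityMeasure ν] in
lemma one_sub_cdf_nonneg (x : ℝ) : 0 ≤ 1 - cdf ν x := sub_nonneg.2 (cdf_le_one ν x)

omit [IsProbabilityMeasure ν] in
lemma measurable_one_sub_cdf : Measurable fun u : ℝ => 1 - cdf ν u :=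
  (cdf ν).mono.measurable.const_sub 1

/-- The layer-cake formula for the excess of an offer over `x`. -/
lemma lintegral_one_sub_cdf (x : ℝ) :
    ∫⁻ u in Ioi x, ENNReal.ofReal (1 - cdf ν u) = ∫⁻ u, ENNReal.ofReal (max (u - x) 0) ∂ν := by
  rw [lintegral_eq_lintegral_meas_lt (f := fun u => max (u - x) 0) ν
    (ae_of_all _ fun u => le_max_right _ _) (by fun_prop)]
  have hmp : MeasurePreserving (fun t : ℝ => t + x) (volume.restrict (Ioi 0))
      (volume.restrict (Ioi x)) := by
    have h := (measurePreserving_add_right volume x).restrict_preimage (measurableSet_Ioi (a := x))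
    simpa using h
  rw [← hmp.lintegral_comp measurable_one_sub_cdf.ennreal_ofReal]
  refine setLIntegral_congr_fun measurableSet_Ioi fun t ht => ?_
  simp only [setOf_lt_sub_posPart ht, ← measureReal_Ioi_eq_one_sub_cdf]
  exact ofReal_measureReal (measure_ne_top _ _)

lemma phi_eq_integral_posPart (x : ℝ) : phi ν x = ∫ u, max (u - x) 0 ∂ν := by
  rw [phi, integral_eq_lintegral_of_nonneg_ae (ae_of_all _ one_sub_cdf_nonneg)
    measurable_one_sub_cdf.aestronglyMeasurable, lintegral_one_sub_cdf,
    integral_eq_lintegral_of_nonneg_ae (f := fun u => max (u - x) 0)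
      (ae_of_all _ fun u => le_max_right _ _) (by fun_prop)]

variable (hν : Integrable (fun x : ℝ => max x 0) ν)
include hν

lemma integrableOn_one_sub_cdf (x : ℝ) : IntegrableOn (fun u : ℝ => 1 - cdf ν u) (Ioi x) := by
  refine ⟨measurable_one_sub_cdf.aestronglyMeasurable, ?_⟩
  rw [hasFiniteIntegral_iff_ofReal (ae_of_all _ one_sub_cdf_nonneg), lintegral_one_sub_cdf]
  exact (integrable_sub_posPart hν x).lintegral_lt_top

lemma antitone_phi : Antitone (phi ν) := fun x y hxy => by
  rw [phi_eq_integral_posPart, phi_eq_integral_posPart]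
  exact integral_mono (integrable_sub_posPart hν y) (integrable_sub_posPart hν x)
    fun u => max_le_max_right _ (by linarith)

lemma phi_le_add {x y : ℝ} (hxy : x ≤ y) : phi ν x ≤ phi ν y + (y - x) := by
  rw [phi_eq_integral_posPart, phi_eq_integral_posPart]
  calc ∫ u, max (u - x) 0 ∂ν ≤ ∫ u, (max (u - y) 0 + (y - x)) ∂ν := by
        refine integral_mono (integrable_sub_posPart hν x)
          ((integrable_sub_posPart hν y).add (integrable_const _)) fun u => ?_
        refine max_le ?_ (add_nonneg (le_max_right _ _) (sub_nonneg.2 hxy))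
        linarith [le_max_left (u - y) 0]
    _ = _ := by
        rw [integral_add (integrable_sub_posPart hν y) (integrable_const _)]
        simp

lemma lipschitzWith_phi : LipschitzWith 1 (phi ν) := by
  refine LipschitzWith.of_le_add fun x y => ?_
  rcases le_total x y with h | h
  · rw [Real.dist_eq, abs_sub_comm, abs_of_nonneg (sub_nonneg.2 h)]
    exact phi_le_add hν h
  · exact (antitone_phi hν h).trans (le_add_of_nonneg_right dist_nonneg)

lemma tendsto_phi_atTop : Tendsto (phi ν) atTop (𝓝 0) := by
  have h : Tendsto (fun x => ∫ u, max (u - x) 0 ∂ν) atTop (𝓝 (∫ _, (0 : ℝ) ∂ν)) := by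
    refine tendsto_integral_filter_of_dominated_convergence (fun u => max u 0)
      (Eventually.of_forall fun x => by fun_prop) ?_ hν (ae_of_all _ fun u => ?_)
    · filter_upwards [eventually_ge_atTop 0] with x hx
      refine ae_of_all _ fun u => ?_
      rw [Real.norm_of_nonneg (le_max_right _ _)]
      exact max_le_max_right _ (by linarith)
    · refine tendsto_const_nhds.congr' ?_
      filter_upwards [eventually_ge_atTop u] with x hx
      rw [max_eq_right (by linarith)]
  simpa [funext (phi_eq_integral_posPart)] using h

lemma phi_pos_iff_lt_maxOffer {x : ℝ} : 0 < phi ν x ↔ (x : EReal) < maxOffer ν := by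
  constructor
  · intro h
    by_contra hx
    refine h.ne' (setIntegral_eq_zero_of_forall_eq_zero fun u hu => ?_)
    by_contra hne
    refine hx ((EReal.coe_lt_coe_iff.2 hu).trans_le (le_sSup ⟨u, ?_, rfl⟩))
    exact lt_of_le_of_ne (cdf_le_one ν u) fun h1 => hne (by rw [h1, sub_self])
  · intro h
    obtain ⟨_, ⟨y, hy, rfl⟩, hxy⟩ := lt_sSup_iff.1 h
    have hxy : x < y := EReal.coe_lt_coe_iff.1 hxy
    have hy : cdf ν y < 1 := hy
    calc (0 : ℝ) < (y - x) * (1 - cdf ν y) := mul_pos (by linarith) (by linarith)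
      _ = ∫ _ in Ioc x y, (1 - cdf ν y) := by simp [hxy.le]
      _ ≤ ∫ u in Ioc x y, (1 - cdf ν u) := by
          refine setIntegral_mono_on (by simp) ((integrableOn_one_sub_cdf hν x).mono_set
            Ioc_subset_Ioi_self) measurableSet_Ioc fun u hu => ?_
          linarith [monotone_cdf ν hu.2]
      _ ≤ phi ν x := setIntegral_mono_set (integrableOn_one_sub_cdf hν x)
          (ae_of_all _ one_sub_cdf_nonneg) (Eventually.of_forall Ioc_subset_Ioi_self)

/-- `E[max (X, c)] = c + φ c`. -/
lemma integral_max_eq_add_phi (c : ℝ) : ∫ u, max u c ∂ν = c + phi ν c := by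
  have h : ∀ u : ℝ, max u c = c + max (u - c) 0 := fun u => by
    rw [← max_add_add_left]; simp
  simp_rw [h]
  rw [integral_add (integrable_const _) (integrable_sub_posPart hν c), phi_eq_integral_posPart]
  simp

end Phi

/-! ### The autonomous equation `y' = r f(y)` -/

section Autonomous

variable {f : ℝ → ℝ} {a : ℝ}

/-- A primitive of `1 / f`; for `f = φ` and `a = μ₀` it is the function `Ψ`. -/
noncomputable def recipPrimitive (f : ℝ → ℝ) (a x : ℝ) : ℝ := ∫ u in a..x, 1 / f u

/-- The solution of `y' = r f(y)`, `y(0) = a`, as the inverse of a primitive of `1 / f`. It is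
extended to negative times by the constant `a`, so that it is continuous and monotone on `ℝ`. -/
noncomputable def flow (f : ℝ → ℝ) (a r t : ℝ) : ℝ :=
  Function.invFunOn (recipPrimitive f a) {x | a ≤ x ∧ 0 < f x} (r * max t 0)

variable (hL : LipschitzWith 1 f) (hf : Antitone f)
include hL hf

lemma intervalIntegrable_one_div {x y : ℝ} (hx : 0 < f x) (hy : 0 < f y) :
    IntervalIntegrable (fun u => 1 / f u) volume x y := by
  refine ContinuousOn.intervalIntegrable
    (continuousOn_const.div hL.continuous.continuousOn fun u hu => ?_)
  rcases le_max_iff.1 hu.2 with h | h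
  · exact (hx.trans_le (hf h)).ne'
  · exact (hy.trans_le (hf h)).ne'

lemma recipPrimitive_sub (ha : 0 < f a) {x y : ℝ} (hx : 0 < f x) (hy : 0 < f y) :
    recipPrimitive f a y - recipPrimitive f a x = ∫ u in x..y, 1 / f u :=
  intervalIntegral.integral_interval_sub_left (intervalIntegrable_one_div hL hf ha hy)
    (intervalIntegrable_one_div hL hf ha hx)

lemma hasDerivAt_recipPrimitive (ha : 0 < f a) {x : ℝ} (hx : 0 < f x) :
    HasDerivAt (recipPrimitive f a) (f x)⁻¹ x := by
  rw [← one_div]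
  refine intervalIntegral.integral_hasDerivAt_right (intervalIntegrable_one_div hL hf ha hx) ?_ ?_
  · have h : Measurable fun u => 1 / f u := measurable_const.div hL.continuous.measurable
    exact h.stronglyMeasurable.stronglyMeasurableAtFilter
  · exact continuousAt_const.div hL.continuous.continuousAt hx.ne'

/-- As `f` is antitone, `1 / f` is at least `1 / f a` to the right of `a`. -/
lemma le_recipPrimitive_sub (ha : 0 < f a) {x y : ℝ} (hax : a ≤ x) (hxy : x ≤ y) (hy : 0 < f y) :
    (y - x) / f a ≤ recipPrimitive f a y - recipPrimitive f a x := by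
  have hx : 0 < f x := hy.trans_le (hf hxy)
  rw [recipPrimitive_sub hL hf ha hx hy]
  calc (y - x) / f a = ∫ _ in x..y, 1 / f a := by simp [div_eq_mul_inv]
    _ ≤ _ := intervalIntegral.integral_mono_on hxy (by simp)
      (intervalIntegrable_one_div hL hf hx hy)
      fun u hu => one_div_le_one_div_of_le (hy.trans_le (hf hu.2)) (hf (hax.trans hu.1))

/-- Since `f` has slope at most `1`, `f u ≤ f x + (x - u)` for `u ≤ x`, so the primitive of `1 / f`
grows at least logarithmically as `f x` tends to `0`. -/
lemma log_le_recipPrimitive {x : ℝ} (hax : a ≤ x) (hx : 0 < f x) :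
    Real.log (f a / f x) ≤ recipPrimitive f a x := by
  have hlip : ∀ u ≤ x, f u ≤ f x + (x - u) := fun u hu => by
    have := hL.le_add_mul u x
    rwa [Real.dist_eq, abs_sub_comm, abs_of_nonneg (sub_nonneg.2 hu), NNReal.coe_one,
      one_mul] at this
  have ha : 0 < f a := hx.trans_le (hf hax)
  have hpos : ∀ u ∈ uIcc a x, 0 < f x + (x - u) := fun u hu => by
    rw [uIcc_of_le hax] at hu; linarith [hu.2]
  have hcont : ContinuousOn (fun u => 1 / (f x + (x - u))) (uIcc a x) :=
    continuousOn_const.div (by fun_prop) fun u hu => (hpos u hu).ne'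
  have hint : ∫ u in a..x, 1 / (f x + (x - u)) = Real.log ((f x + (x - a)) / f x) := by
    have hd : ∀ u ∈ uIcc a x,
        HasDerivAt (fun u => -Real.log (f x + (x - u))) (1 / (f x + (x - u))) u := fun u hu => by
      have h := ((((hasDerivAt_id u).const_sub x).const_add (f x)).log (hpos u hu).ne').neg
      convert! h using 1
      simp [neg_div]
    rw [intervalIntegral.integral_eq_sub_of_hasDerivAt hd hcont.intervalIntegrable,
      Real.log_div (hpos a left_mem_uIcc).ne' hx.ne']
    simp; ring
  calc Real.log (f a / f x) ≤ Real.log ((f x + (x - a)) / f x) :=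
        Real.log_le_log (div_pos ha hx) (by gcongr; exact hlip a hax)
    _ = ∫ u in a..x, 1 / (f x + (x - u)) := hint.symm
    _ ≤ _ := intervalIntegral.integral_mono_on hax hcont.intervalIntegrable
      (intervalIntegrable_one_div hL hf ha hx)
      fun u hu => one_div_le_one_div_of_le (hx.trans_le (hf hu.2)) (hlip u hu.2)

lemma bijOn_recipPrimitive (hlim : Tendsto f atTop (𝓝 0)) (ha : 0 < f a) :
    BijOn (recipPrimitive f a) {x | a ≤ x ∧ 0 < f x} (Ici 0) := by
  have hmono : ∀ x ∈ {x | a ≤ x ∧ 0 < f x}, ∀ y ∈ {x | a ≤ x ∧ 0 < f x}, x < y →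
      recipPrimitive f a x < recipPrimitive f a y := fun x hx y hy hxy => by
    have := le_recipPrimitive_sub hL hf ha hx.1 hxy.le hy.2
    have := div_pos (sub_pos.2 hxy) ha
    linarith
  have ha0 : recipPrimitive f a a = 0 := intervalIntegral.integral_same
  refine ⟨fun x hx => ?_, StrictMonoOn.injOn hmono, fun c hc => ?_⟩
  · have := le_recipPrimitive_sub hL hf ha le_rfl hx.1 hx.2
    have := div_nonneg (sub_nonneg.2 hx.1) ha.le
    rw [mem_Ici]
    linarith
  · have hc : 0 ≤ c := hc
    -- a point where `f` has dropped by the factor `exp (-c)`; there the primitive exceeds `c`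
    obtain ⟨b, hb1, hb2⟩ : ∃ b, a ≤ b ∧ f b < f a * Real.exp (-c) :=
      ((eventually_ge_atTop a).and
        (hlim.eventually_lt_const (mul_pos ha (Real.exp_pos _)))).exists
    have hle : f a * Real.exp (-c) ≤ f a :=
      mul_le_of_le_one_right ha.le (Real.exp_le_one_iff.2 (by linarith))
    obtain ⟨x, hx, hfx⟩ := intermediate_value_Icc' hb1 hL.continuous.continuousOn ⟨hb2.le, hle⟩
    have hfx0 : 0 < f x := hfx ▸ mul_pos ha (Real.exp_pos _)
    have hcx : c ≤ recipPrimitive f a x := by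
      have h := log_le_recipPrimitive hL hf hx.1 hfx0
      rwa [hfx, Real.exp_neg, ← div_eq_mul_inv, div_div_cancel₀ ha.ne', Real.log_exp] at h
    have hcont : ContinuousOn (recipPrimitive f a) (Icc a x) := fun u hu =>
      (hasDerivAt_recipPrimitive hL hf ha
        (hfx0.trans_le (hf hu.2))).continuousAt.continuousWithinAt
    obtain ⟨u, hu, huc⟩ := intermediate_value_Icc hx.1 hcont ⟨ha0.trans_le hc, hcx⟩
    exact ⟨u, ⟨hu.1, hfx0.trans_le (hf hu.2)⟩, huc⟩

variable (hlim : Tendsto f atTop (𝓝 0)) (ha : 0 < f a) {r : ℝ} (hr : 0 < r)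
include hlim ha hr

lemma flow_mem (t : ℝ) : flow f a r t ∈ {x | a ≤ x ∧ 0 < f x} :=
  Function.invFunOn_mem ((bijOn_recipPrimitive hL hf hlim ha).surjOn
    (mul_nonneg hr.le (le_max_right t 0)))

lemma recipPrimitive_flow (t : ℝ) : recipPrimitive f a (flow f a r t) = r * max t 0 :=
  Function.invFunOn_eq ((bijOn_recipPrimitive hL hf hlim ha).surjOn
    (mul_nonneg hr.le (le_max_right t 0)))

lemma flow_zero : flow f a r 0 = a := by
  refine (bijOn_recipPrimitive hL hf hlim ha).injOn (flow_mem hL hf hlim ha hr 0) ⟨le_rfl, ha⟩ ?_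
  rw [recipPrimitive_flow hL hf hlim ha hr]
  simp [recipPrimitive]

lemma monotone_flow : Monotone (flow f a r) := fun s t hst => by
  by_contra! h
  have h1 := le_recipPrimitive_sub hL hf ha (flow_mem hL hf hlim ha hr t).1 h.le
    (flow_mem hL hf hlim ha hr s).2
  rw [recipPrimitive_flow hL hf hlim ha hr, recipPrimitive_flow hL hf hlim ha hr] at h1
  have h2 := div_pos (sub_pos.2 h) ha
  have h3 : r * max s 0 ≤ r * max t 0 := by gcongr
  linarith

lemma continuous_flow : Continuous (flow f a r) := by
  refine (LipschitzWith.of_le_add_mul (Real.toNNReal (f a * r)) fun s t => ?_).continuous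
  rw [Real.coe_toNNReal _ (mul_pos ha hr).le, Real.dist_eq]
  rcases le_total s t with h | h
  · exact (monotone_flow hL hf hlim ha hr h).trans
      (le_add_of_nonneg_right (mul_nonneg (mul_pos ha hr).le (abs_nonneg _)))
  have h1 := le_recipPrimitive_sub hL hf ha (flow_mem hL hf hlim ha hr t).1
    (monotone_flow hL hf hlim ha hr h) (flow_mem hL hf hlim ha hr s).2
  rw [recipPrimitive_flow hL hf hlim ha hr, recipPrimitive_flow hL hf hlim ha hr, ← mul_sub,
    div_le_iff₀ ha] at h1
  have h2 : max s 0 - max t 0 ≤ |s - t| :=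
    (le_abs_self _).trans (abs_max_sub_max_le_abs s t 0)
  nlinarith [mul_le_mul_of_nonneg_left h2 (mul_pos ha hr).le]

lemma hasDerivWithinAt_flow {t : ℝ} (ht : 0 ≤ t) :
    HasDerivWithinAt (flow f a r) (r * f (flow f a r t)) (Ici 0) t := by
  have hpos := (flow_mem hL hf hlim ha hr t).2
  -- `flow` is a right inverse of `r⁻¹` times the primitive, whose derivative at the point is
  -- `(r f)⁻¹`
  have hd := (hasDerivAt_recipPrimitive hL hf ha hpos).const_mul r⁻¹
  have hne : r⁻¹ * (f (flow f a r t))⁻¹ ≠ 0 := by positivity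
  have key := HasFDerivWithinAt.of_local_left_inverse (s := Ici (0 : ℝ)) (t := univ)
    (g := flow f a r) (a := t)
    (by
      rw [nhdsWithin_univ]
      exact (continuous_flow hL hf hlim ha hr).continuousWithinAt)
    (hd.hasFDerivAt_equiv hne).hasFDerivWithinAt ht
    (by
      filter_upwards [self_mem_nhdsWithin] with s hs
      rw [recipPrimitive_flow hL hf hlim ha hr, max_eq_left hs, inv_mul_cancel_left₀ hr.ne'])
  have := key.hasDerivWithinAt
  simpa [mul_comm] using this

omit hf hlim ha hr in
/-- Uniqueness for `y' = r f(y)` on `[0, ∞)`, with a one-sided derivative at `0`. -/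
lemma eq_of_hasDerivWithinAt_Ici {y z : ℝ → ℝ}
    (hy : ∀ t, 0 ≤ t → HasDerivWithinAt y (r * f (y t)) (Ici 0) t)
    (hz : ∀ t, 0 ≤ t → HasDerivWithinAt z (r * f (z t)) (Ici 0) t) (h0 : y 0 = z 0) {t : ℝ}
    (ht : 0 ≤ t) : y t = z t := by
  have hv : ∀ _ : ℝ, LipschitzWith (‖r‖₊ * 1) fun x => r * f x := fun _ =>
    (lipschitzWith_smul r).comp hL
  refine ODE_solution_unique (v := fun _ x => r * f x) hv
    (fun s hs => ((hy s hs.1).mono Icc_subset_Ici_self).continuousWithinAt)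
    (fun s hs => (hy s hs.1).mono (Ici_subset_Ici.2 hs.1))
    (fun s hs => ((hz s hs.1).mono Icc_subset_Ici_self).continuousWithinAt)
    (fun s hs => (hz s hs.1).mono (Ici_subset_Ici.2 hs.1)) h0 ⟨ht, le_rfl⟩

end Autonomous

/-! ### The Bellman equation -/

lemma integral_expMeasure (r : ℝ) (hr : 0 < r) (f : ℝ → ℝ) :
    ∫ x, f x ∂(expMeasure r) = ∫ x in Ioi 0, r * Real.exp (-(r * x)) * f x := by
  have h : expMeasure r =
      volume.withDensity fun x => ENNReal.ofReal (exponentialPDFReal r x) := rfl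
  rw [h, integral_withDensity_eq_integral_toReal_smul
    (measurable_exponentialPDFReal r).ennreal_ofReal (ae_of_all _ fun x => ENNReal.ofReal_lt_top),
    ← integral_Ici_eq_integral_Ioi, ← integral_indicator measurableSet_Ici]
  refine integral_congr_ae (ae_of_all _ fun x => ?_)
  simp only [← exponentialPDF.eq_1, exponentialPDF_eq, indicator_apply, mem_Ici]
  split_ifs with hx
  · rw [ENNReal.toReal_ofReal (by positivity), smul_eq_mul]
  · simp

lemma ae_pos_expMeasure (r : ℝ) : ∀ᵐ x ∂(expMeasure r), 0 < x := by
  have h : expMeasure r =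
      volume.withDensity fun x => ENNReal.ofReal (exponentialPDFReal r x) := rfl
  rw [h, ae_withDensity_iff (measurable_exponentialPDFReal r).ennreal_ofReal]
  filter_upwards [compl_mem_ae_iff.2 (Real.volume_singleton (a := 0))] with x hx0 hx
  by_contra! hneg
  exact hx (exponentialPDF_of_neg (lt_of_le_of_ne hneg hx0))

/-- The value of an offer `x` with `s` time units left, when rejecting it is worth `m s` and the
asset is worth `m 0` at the deadline. -/
noncomputable def offerValue (m : ℝ → ℝ) (s x : ℝ) : ℝ := if 0 < s then max x (m s) else m 0

section Bellman

variable {ν : Measure ℝ} [IsProbabilityMeasure ν] {m : ℝ → ℝ} {r : ℝ}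

lemma measurable_offerValue (hm : Measurable m) :
    Measurable fun p : ℝ × ℝ => offerValue m p.1 p.2 :=
  Measurable.ite (measurableSet_lt measurable_const measurable_fst)
    (measurable_snd.max (hm.comp measurable_fst)) measurable_const

lemma le_offerValue (hm : Monotone m) (s x : ℝ) : m s ≤ offerValue m s x := by
  unfold offerValue
  split_ifs with h
  · exact le_max_right _ _
  · exact hm (not_lt.1 h)

lemma offerValue_nonneg (hm : Monotone m) (hm0 : 0 ≤ m 0) {s : ℝ} (hs : 0 ≤ s) (x : ℝ) :
    0 ≤ offerValue m s x :=
  (hm0.trans (hm hs)).trans (le_offerValue hm s x)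

lemma integral_offerValue (hν : Integrable (fun x : ℝ => max x 0) ν) (s : ℝ) :
    ∫ x, offerValue m s x ∂ν = if 0 < s then m s + phi ν (m s) else m 0 := by
  unfold offerValue
  split_ifs with h
  · exact integral_max_eq_add_phi hν _
  · simp

variable (hν : Integrable (fun x : ℝ => max x 0) ν) (hr : 0 < r) (hmono : Monotone m)
  (hm0 : 0 ≤ m 0)
include hν hr hmono hm0

lemma integrable_offerValue (t : ℝ) (ht : 0 ≤ t) :
    Integrable (fun z : ℝ × ℝ => offerValue m (max (t - z.1) 0) z.2) ((expMeasure r).prod ν) := by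
  have := isProbabilityMeasure_expMeasure hr
  have hpos : Integrable (fun z : ℝ × ℝ => max z.2 0) ((expMeasure r).prod ν) :=
    hν.comp_snd (expMeasure r)
  refine (hpos.add (integrable_const (m t))).mono'
    ((measurable_offerValue hmono.measurable).comp (f := fun z : ℝ × ℝ => (max (t - z.1) 0, z.2))
      (by fun_prop)).aestronglyMeasurable ?_
  filter_upwards [Measure.quasiMeasurePreserving_fst.ae (ae_pos_expMeasure r)] with z hz
  rw [Real.norm_of_nonneg (offerValue_nonneg hmono hm0 (le_max_right _ _) _)]
  have hmt : m (max (t - z.1) 0) ≤ m t := hmono (max_le (by linarith) ht)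
  have h0 : m 0 ≤ m t := hmono ht
  simp only [offerValue, Pi.add_apply]
  split_ifs
  · refine max_le ?_ ?_ <;> linarith [le_max_left z.2 0, le_max_right z.2 0]
  · linarith [le_max_right z.2 0]

/-- A solution `m` of `m' = r φ(m)` satisfies the Bellman equation
`m(t) = E[offerValue m ((t - D)₊) X]`. After integrating out `X` the integrand on `[0, t]` is the
derivative of `- e^{-r u} m(t - u)`. -/
lemma bellman (hcont : Continuous m)
    (hderiv : ∀ t, 0 ≤ t → HasDerivWithinAt m (r * phi ν (m t)) (Ici 0) t) (t : ℝ) (ht : 0 ≤ t) :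
    ∫ z : ℝ × ℝ, offerValue m (max (t - z.1) 0) z.2 ∂((expMeasure r).prod ν) = m t := by
  have := isProbabilityMeasure_expMeasure hr
  set g : ℝ → ℝ := fun u => r * Real.exp (-(r * u)) * (m (t - u) + phi ν (m (t - u))) with hg
  have hgcont : Continuous g := by
    have := (lipschitzWith_phi hν).continuous
    fun_prop
  have hE : ∀ u : ℝ, HasDerivAt (fun u => -Real.exp (-(r * u))) (r * Real.exp (-(r * u))) u :=
    fun u => hasDerivAt_neg_exp_mul_exp
  have hFTC : ∫ u in 0..t, g u = m t - Real.exp (-(r * t)) * m 0 := by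
    rw [intervalIntegral.integral_eq_sub_of_hasDerivAt_of_le
      (f := fun u => -Real.exp (-(r * u)) * m (t - u)) ht (by fun_prop) (fun u hu => ?_)
      (hgcont.intervalIntegrable _ _)]
    · simp; ring
    · have hd : HasDerivAt m (r * phi ν (m (t - u))) (t - u) :=
        (hderiv (t - u) (by linarith [hu.2])).hasDerivAt (Ici_mem_nhds (by linarith [hu.2]))
      have hd' := (hE u).mul (hd.comp_const_sub t u)
      convert! hd' using 1
      simp only [hg]; ring
  -- the part of the integral beyond the deadline
  have hexp : IntegrableOn (fun u => r * Real.exp (-(r * u)) * m 0) (Ioi t) := by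
    have h := ((exp_neg_integrableOn_Ioi t hr).const_mul r).mul_const (m 0)
    simp only [neg_mul] at h
    exact h
  have htail : ∫ u in Ioi t, r * Real.exp (-(r * u)) * m 0 = Real.exp (-(r * t)) * m 0 := by
    rw [integral_mul_const, integral_const_mul]
    have h := integral_exp_mul_Ioi (neg_lt_zero.2 hr) t
    simp only [neg_mul] at h
    rw [h]
    field_simp
  rw [integral_prod _ (integrable_offerValue hν hr hmono hm0 t ht)]
  simp only [integral_offerValue hν]
  rw [integral_expMeasure r hr]
  set k : ℝ → ℝ := fun u => if u ≤ t then g u else r * Real.exp (-(r * u)) * m 0 with hk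
  have hk1 : EqOn k g (Ioc 0 t) := fun u hu => if_pos hu.2
  have hk2 : EqOn k (fun u => r * Real.exp (-(r * u)) * m 0) (Ioi t) :=
    fun u hu => if_neg (not_le.2 hu)
  calc _ = ∫ u in Ioi 0, k u := by
        -- the integrands agree except at `u = t`
        refine integral_congr_ae (ae_restrict_of_ae ?_)
        filter_upwards [compl_mem_ae_iff.2 (Real.volume_singleton (a := t))] with u hu
        rcases lt_or_gt_of_ne (show u ≠ t from hu) with h | h
        · have h' : 0 < t - u := sub_pos.2 h
          simp [hk, hg, h.le, h']
        · have h' : t - u ≤ 0 := sub_nonpos.2 h.le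
          simp [hk, h.not_ge, max_eq_right h']
    _ = (∫ u in Ioc 0 t, k u) + ∫ u in Ioi t, k u := by
        rw [← Ioc_union_Ioi_eq_Ioi ht]
        refine setIntegral_union Ioc_disjoint_Ioi_same measurableSet_Ioi ?_ ?_
        · exact ((hgcont.integrableOn_Icc).mono_set Ioc_subset_Icc_self).congr_fun hk1.symm
            measurableSet_Ioc
        · exact hexp.congr_fun hk2.symm measurableSet_Ioi
    _ = m t := by
        rw [setIntegral_congr_fun measurableSet_Ioc hk1,
          setIntegral_congr_fun measurableSet_Ioi hk2, htail, ← intervalIntegral.integral_of_le ht, hFTC]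
        ring

end Bellman

/-- A threshold function `m` that solves the Bellman equation of the selling problem: rejecting an
offer with `t` time units left and then proceeding optimally is worth `m t`. The value at the
deadline, `m 0`, is nonnegative. -/
structure IsBellmanSolution (ν : Measure ℝ) (r : ℝ) (m : ℝ → ℝ) : Prop where
  monotone : Monotone m
  nonneg : 0 ≤ m 0
  integrable : ∀ t, 0 ≤ t → Integrable (fun z : ℝ × ℝ => offerValue m (max (t - z.1) 0) z.2)
    ((expMeasure r).prod ν)
  integral_eq : ∀ t, 0 ≤ t →
    ∫ z : ℝ × ℝ, offerValue m (max (t - z.1) 0) z.2 ∂((expMeasure r).prod ν) = m t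

lemma IsBellmanSolution.lintegral_eq {ν : Measure ℝ} {r : ℝ} {m : ℝ → ℝ}
    (hm : IsBellmanSolution ν r m) {t : ℝ} (ht : 0 ≤ t) :
    ∫⁻ z : ℝ × ℝ, ENNReal.ofReal (offerValue m (max (t - z.1) 0) z.2) ∂((expMeasure r).prod ν) =
      ENNReal.ofReal (m t) := by
  rw [← hm.integral_eq t ht, ofReal_integral_eq_lintegral_ofReal (hm.integrable t ht)
    (ae_of_all _ fun z => offerValue_nonneg hm.monotone hm.nonneg (le_max_right _ _) _)]

/-! ### The arrival process -/

/-- A function that is measurable along each fibre of a countable measurable partition is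
measurable. -/
lemma measurable_of_countable_fibers {Ω ι β : Type*} {mΩ : MeasurableSpace Ω} [MeasurableSpace β]
    [Countable ι] {τ : Ω → ι} (hτ : ∀ k, MeasurableSet {ω | τ ω = k}) {f : Ω → β} (F : ι → Ω → β)
    (hF : ∀ k, Measurable (F k)) (hf : ∀ ω, f ω = F (τ ω) ω) : Measurable f := by
  intro s hs
  have h : f ⁻¹' s = ⋃ k, {ω | τ ω = k} ∩ F k ⁻¹' s := by
    ext ω
    simp [hf]
  rw [h]
  exact MeasurableSet.iUnion fun k => (hτ k).inter (hF k hs)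

namespace BiddingProcess

variable {Ω : Type*} [mΩ : MeasurableSpace Ω] {P : Measure Ω} {r : ℝ} {ν ν₀ : Measure ℝ}
  (B : BiddingProcess P r ν ν₀)

/-- The information available just before offer `n` arrives. -/
@[reducible] def past : ℕ → MeasurableSpace Ω
  | 0 => ⊥
  | n + 1 => B.history n

lemma past_le (n : ℕ) : B.past n ≤ mΩ := by
  cases n with
  | zero => exact bot_le
  | succ n => exact B.history.le n

lemma past_le_history (n : ℕ) : B.past n ≤ B.history n := by
  cases n with
  | zero => exact bot_le
  | succ n => exact B.history.mono n.le_succ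

lemma measurable_arrival {k n : ℕ} (hkn : k ≤ n) :
    Measurable[B.history n] fun ω => (B.wait k ω, B.offer k ω) :=
  measurable_iff_comap_le.2
    (le_iSup₂_of_le (f := fun j (_ : j ≤ n) =>
      MeasurableSpace.comap (fun ω => (B.wait j ω, B.offer j ω)) inferInstance) k hkn le_rfl)

lemma measurable_remaining_past (t : ℝ) (n : ℕ) : Measurable[B.past n] (B.remaining t n) := by
  induction n with
  | zero => exact @measurable_const _ _ _ (_) _
  | succ n ih =>
    have h1 : Measurable[B.history n] (B.remaining t n) := ih.mono (B.past_le_history n) le_rfl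
    have h2 : Measurable[B.history n] (B.wait n) := (B.measurable_arrival le_rfl).fst
    exact (h1.sub h2).max measurable_const

lemma measurable_remaining (t : ℝ) (n : ℕ) : Measurable (B.remaining t n) :=
  (B.measurable_remaining_past t n).mono (B.past_le n) le_rfl

lemma remaining_nonneg {t : ℝ} (ht : 0 ≤ t) (n : ℕ) (ω : Ω) : 0 ≤ B.remaining t n ω := by
  cases n with
  | zero => exact ht
  | succ n => exact le_max_right _ _

variable [IsProbabilityMeasure P]

/-- Each arrival is independent of the past. -/
lemma indep_past (n : ℕ) :
    Indep (B.past n) (MeasurableSpace.comap (fun ω => (B.wait n ω, B.offer n ω)) inferInstance)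
      P := by
  cases n with
  | zero => exact indep_bot_left _
  | succ n => exact (iIndepFun.indep_comap_natural_of_lt
      (fun i => ((B.measurable_wait i).prodMk (B.measurable_offer i)).stronglyMeasurable)
      B.iIndepFun_arrivals n.lt_succ_self).symm

lemma map_arrival (n : ℕ) :
    P.map (fun ω => (B.wait n ω, B.offer n ω)) = (expMeasure r).prod ν := by
  rw [(B.indepFun_wait_offer n).map_prod_eq_prod_map_map (B.measurable_wait n).aemeasurable
    (B.measurable_offer n).aemeasurable, (B.hasLaw_wait n).map_eq, (B.hasLaw_offer n).map_eq]

/-- The next arrival may be integrated out, with the past held fixed. -/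
lemma lintegral_past_arrival [IsProbabilityMeasure ν] (hr : 0 < r) {β : Type*}
    [MeasurableSpace β] {n : ℕ} {U : Ω → β} (hU : Measurable[B.past n] U)
    {f : β × (ℝ × ℝ) → ENNReal} (hf : Measurable f) :
    ∫⁻ ω, f (U ω, (B.wait n ω, B.offer n ω)) ∂P =
      ∫⁻ ω, ∫⁻ z, f (U ω, z) ∂((expMeasure r).prod ν) ∂P := by
  have := isProbabilityMeasure_expMeasure hr
  have hU' : Measurable U := hU.mono (B.past_le n) le_rfl
  have hZ : Measurable fun ω => (B.wait n ω, B.offer n ω) :=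
    (B.measurable_wait n).prodMk (B.measurable_offer n)
  have hind : IndepFun U (fun ω => (B.wait n ω, B.offer n ω)) P :=
    (IndepFun_iff_Indep _ _ _).2 (indep_of_indep_of_le_left (B.indep_past n) hU.comap_le)
  have := Measure.isProbabilityMeasure_map (μ := P) hU'.aemeasurable
  rw [← lintegral_map (g := fun ω => (U ω, (B.wait n ω, B.offer n ω))) hf (hU'.prodMk hZ),
    hind.map_prod_eq_prod_map_map hU'.aemeasurable hZ.aemeasurable, B.map_arrival,
    lintegral_prod _ hf.aemeasurable, lintegral_map hf.lintegral_prod_right' hU']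

omit [IsProbabilityMeasure P] in
lemma ae_wait_pos : ∀ᵐ ω ∂P, ∀ i, 0 < B.wait i ω := by
  refine ae_all_iff.2 fun i => ?_
  have h := ae_pos_expMeasure r
  rw [← (B.hasLaw_wait i).map_eq] at h
  exact ae_of_ae_map (B.measurable_wait i).aemeasurable h

omit [IsProbabilityMeasure P] in
lemma antitone_remaining {t : ℝ} (ht : 0 ≤ t) {ω : Ω} (hω : ∀ i, 0 < B.wait i ω) :
    Antitone fun n => B.remaining t n ω :=
  antitone_nat_of_succ_le fun n =>
    max_le (by linarith [hω n]) (B.remaining_nonneg ht n ω)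

/-- Chernoff's bound for the time of the `n`-th arrival: with `D` the time between two arrivals,
`E[e^{t_n}; t_n > 0] ≤ e^t E[e^{-D}]^n`. -/
lemma lintegral_exp_remaining_le [IsProbabilityMeasure ν] (hr : 0 < r) (t : ℝ) (n : ℕ) :
    ∫⁻ ω, (Ioi 0).indicator (fun s => ENNReal.ofReal (Real.exp s)) (B.remaining t n ω) ∂P ≤
      (∫⁻ z : ℝ × ℝ, ENNReal.ofReal (Real.exp (-z.1)) ∂((expMeasure r).prod ν)) ^ n *
        ENNReal.ofReal (Real.exp t) := by
  have hmeas : Measurable ((Ioi (0 : ℝ)).indicator fun s => ENNReal.ofReal (Real.exp s)) :=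
    (Real.measurable_exp.ennreal_ofReal).indicator measurableSet_Ioi
  induction n with
  | zero =>
    calc _ ≤ ∫⁻ _, ENNReal.ofReal (Real.exp t) ∂P :=
          lintegral_mono fun ω => indicator_le_self (Ioi 0)
            (fun s => ENNReal.ofReal (Real.exp s)) t
      _ = _ := by simp
  | succ n ih =>
    calc _ ≤ ∫⁻ ω, (Ioi 0).indicator (fun s => ENNReal.ofReal (Real.exp s)) (B.remaining t n ω) *
            ENNReal.ofReal (Real.exp (-B.wait n ω)) ∂P := by
          refine lintegral_mono_ae ?_
          filter_upwards [B.ae_wait_pos] with ω hω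
          by_cases h : 0 < B.remaining t (n + 1) ω
          · have h1 : B.remaining t (n + 1) ω = B.remaining t n ω - B.wait n ω := by
              simp only [remaining] at h ⊢
              exact max_eq_left (lt_max_iff.1 h |>.resolve_right (lt_irrefl _)).le
            have h2 : 0 < B.remaining t n ω := by linarith [hω n]
            rw [indicator_of_mem (mem_Ioi.2 h), indicator_of_mem (mem_Ioi.2 h2), h1,
              ← ENNReal.ofReal_mul (Real.exp_pos _).le, ← Real.exp_add, sub_eq_add_neg]
          · rw [indicator_of_notMem (by simpa using h)]
            exact zero_le
      _ = (∫⁻ ω, (Ioi 0).indicator (fun s => ENNReal.ofReal (Real.exp s)) (B.remaining t n ω) ∂P) *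
            ∫⁻ z : ℝ × ℝ, ENNReal.ofReal (Real.exp (-z.1)) ∂((expMeasure r).prod ν) := by
          rw [B.lintegral_past_arrival hr (B.measurable_remaining_past t n)
            (f := fun p => (Ioi 0).indicator (fun s => ENNReal.ofReal (Real.exp s)) p.1 *
              ENNReal.ofReal (Real.exp (-p.2.1)))
            ((hmeas.comp measurable_fst).mul (by fun_prop))]
          simp_rw [lintegral_const_mul _
            (show Measurable fun z : ℝ × ℝ => ENNReal.ofReal (Real.exp (-z.1)) by fun_prop)]
          exact lintegral_mul_const _ (hmeas.comp (B.measurable_remaining t n))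
      _ ≤ _ := by
          rw [pow_succ, mul_right_comm]
          gcongr

/-- Almost surely only finitely many offers arrive before the deadline. -/
lemma ae_eventually_remaining_eq_zero [IsProbabilityMeasure ν] (hr : 0 < r) {t : ℝ}
    (ht : 0 ≤ t) : ∀ᵐ ω ∂P, ∀ᶠ n in atTop, B.remaining t n ω = 0 := by
  have := isProbabilityMeasure_expMeasure hr
  set q := ∫⁻ z : ℝ × ℝ, ENNReal.ofReal (Real.exp (-z.1)) ∂((expMeasure r).prod ν) with hq
  have hlt : ∀ᵐ z ∂((expMeasure r).prod ν), ENNReal.ofReal (Real.exp (-z.1)) < 1 := by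
    filter_upwards [Measure.quasiMeasurePreserving_fst.ae (ae_pos_expMeasure r)] with z hz
    rw [← ENNReal.ofReal_one, ENNReal.ofReal_lt_ofReal_iff one_pos]
    simpa using hz
  have hq1 : q < 1 := by
    have hle : q ≤ ∫⁻ _, 1 ∂((expMeasure r).prod ν) :=
      lintegral_mono_ae (hlt.mono fun z hz => hz.le)
    calc q < ∫⁻ _, 1 ∂((expMeasure r).prod ν) :=
          lintegral_strict_mono (IsProbabilityMeasure.ne_zero _) aemeasurable_const
            (ne_top_of_le_ne_top (by simp) hle) hlt
      _ = 1 := by simp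
  have hle : ∀ n, P {ω | ∀ k, 0 < B.remaining t k ω} ≤ q ^ n * ENNReal.ofReal (Real.exp t) := by
    intro n
    refine le_trans ?_ (B.lintegral_exp_remaining_le hr t n)
    calc P {ω | ∀ k, 0 < B.remaining t k ω} ≤ P (B.remaining t n ⁻¹' Ioi 0) :=
          measure_mono fun ω hω => hω n
      _ = ∫⁻ ω, (B.remaining t n ⁻¹' Ioi 0).indicator 1 ω ∂P :=
          (lintegral_indicator_one (B.measurable_remaining t n measurableSet_Ioi)).symm
      _ ≤ _ := by
          refine lintegral_mono fun ω => ?_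
          by_cases h : B.remaining t n ω ∈ Ioi 0
          · rw [indicator_of_mem h, indicator_of_mem (show ω ∈ B.remaining t n ⁻¹' Ioi 0 from h),
              Pi.one_apply, ENNReal.one_le_ofReal]
            exact Real.one_le_exp (le_of_lt h)
          · rw [indicator_of_notMem (show ω ∉ B.remaining t n ⁻¹' Ioi 0 from h)]
            exact zero_le
  have hlim : Tendsto (fun n => q ^ n * ENNReal.ofReal (Real.exp t)) atTop (𝓝 0) := by
    simpa using ENNReal.Tendsto.mul_const (ENNReal.tendsto_pow_atTop_nhds_zero_of_lt_one hq1)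
      (Or.inr ENNReal.ofReal_ne_top)
  have hzero : P {ω | ∀ k, 0 < B.remaining t k ω} = 0 :=
    le_antisymm (ge_of_tendsto' hlim hle) zero_le
  filter_upwards [B.ae_wait_pos, compl_mem_ae_iff.2 hzero] with ω hω hnot
  obtain ⟨N, hN⟩ : ∃ N, ¬ 0 < B.remaining t N ω := by
    by_contra! h
    exact hnot h
  filter_upwards [eventually_ge_atTop N] with n hn
  exact le_antisymm ((B.antitone_remaining ht hω hn).trans (not_lt.1 hN))
    (B.remaining_nonneg ht n ω)

end BiddingProcess

/-! ### The sale price of a policy -/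

lemma coe_succ_le_iff {n : ℕ} {x : WithTop ℕ} :
    ((n + 1 : ℕ) : WithTop ℕ) ≤ x ↔ (n : WithTop ℕ) < x := by
  cases x with
  | top => exact iff_of_true le_top (WithTop.coe_lt_top n)
  | coe k =>
    change ((n + 1 : ℕ) : WithTop ℕ) ≤ (k : ℕ) ↔ ((n : ℕ) : WithTop ℕ) < (k : ℕ)
    rw [Nat.cast_le, Nat.cast_lt, Nat.succ_le_iff]

lemma coe_succ_le_or {n : ℕ} {x : WithTop ℕ} (h : (n : WithTop ℕ) ≤ x) :
    ((n + 1 : ℕ) : WithTop ℕ) ≤ x ∨ x = n := by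
  rcases h.eq_or_lt with h | h
  · exact Or.inr h.symm
  · exact Or.inl (coe_succ_le_iff.2 h)

lemma not_coe_succ_le (n : ℕ) : ¬ ((n + 1 : ℕ) : WithTop ℕ) ≤ (n : WithTop ℕ) :=
  fun h => lt_irrefl _ (coe_succ_le_iff.1 h)

namespace BiddingProcess

variable {Ω : Type*} [mΩ : MeasurableSpace Ω] {P : Measure Ω} {r : ℝ} {ν ν₀ : Measure ℝ}
  (B : BiddingProcess P r ν ν₀)

open Classical in
/-- The realized sale price under `τ` when the salvage value is the constant `c`. -/
noncomputable def priceOr (t : ℝ) (τ : Ω → WithTop ℕ) (c : ℝ) (ω : Ω) : ℝ :=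
  if h : ∃ n : ℕ, τ ω = (n : WithTop ℕ) ∧ 0 < B.remaining t (n + 1) ω then
    B.offer h.choose ω
  else c

lemma salePrice_eq_priceOr (t : ℝ) (τ : Ω → WithTop ℕ) (ω : Ω) :
    B.salePrice t τ ω = B.priceOr t τ (B.salvage ω) ω := rfl

lemma priceOr_of_eq_coe {t : ℝ} {τ : Ω → WithTop ℕ} {c : ℝ} {ω : Ω} {n : ℕ} (h : τ ω = n) :
    B.priceOr t τ c ω = if 0 < B.remaining t (n + 1) ω then B.offer n ω else c := by
  unfold priceOr
  split_ifs with h1 h2 h2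
  · have hn : h1.choose = n := Nat.cast_injective (h1.choose_spec.1.symm.trans h)
    rw [hn]
  · obtain ⟨k, hk, hk2⟩ := h1
    rw [Nat.cast_injective (hk.symm.trans h)] at hk2
    exact absurd hk2 h2
  · exact absurd ⟨n, h, h2⟩ h1
  · rfl

lemma priceOr_of_eq_top {t : ℝ} {τ : Ω → WithTop ℕ} {c : ℝ} {ω : Ω} (h : τ ω = ⊤) :
    B.priceOr t τ c ω = c := by
  refine dif_neg fun ⟨n, hn, _⟩ => ?_
  rw [h] at hn
  exact WithTop.top_ne_coe hn

variable {B} {τ : Ω → WithTop ℕ}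

lemma IsPolicy.measurableSet_eq_coe (hτ : B.IsPolicy τ) (n : ℕ) :
    MeasurableSet[B.history n] {ω | τ ω = n} :=
  IsStoppingTime.measurableSet_eq hτ n

lemma IsPolicy.measurableSet_eq (hτ : B.IsPolicy τ) (k : WithTop ℕ) :
    MeasurableSet {ω | τ ω = k} := by
  have hcoe : ∀ n : ℕ, MeasurableSet {ω | τ ω = n} := fun n =>
    B.history.le n _ (hτ.measurableSet_eq_coe n)
  induction k using WithTop.recTopCoe with
  | coe n => exact hcoe n
  | top =>
    have h : {ω | τ ω = ⊤} = (⋃ n : ℕ, {ω | τ ω = n})ᶜ := by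
      ext ω
      simp only [mem_ofPred_eq, mem_compl_iff, mem_iUnion]
      refine ⟨fun h ⟨n, hn⟩ => WithTop.top_ne_coe (h.symm.trans hn), fun h => ?_⟩
      by_contra hne
      obtain ⟨n, hn⟩ := WithTop.ne_top_iff_exists.1 hne
      exact h ⟨n, hn.symm⟩
    rw [h]
    exact (MeasurableSet.iUnion hcoe).compl

/-- Whether offer `n` is reached is decided by the past of that offer. -/
lemma IsPolicy.measurableSet_le (hτ : B.IsPolicy τ) (n : ℕ) :
    MeasurableSet[B.past n] {ω | (n : WithTop ℕ) ≤ τ ω} := by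
  cases n with
  | zero => simp
  | succ n =>
    have h : {ω | ((n + 1 : ℕ) : WithTop ℕ) ≤ τ ω} = {ω | τ ω ≤ n}ᶜ := by
      ext ω
      exact coe_succ_le_iff.trans not_le.symm
    rw [h]
    exact (hτ n).compl

lemma IsPolicy.measurable_priceOr (hτ : B.IsPolicy τ) (t c : ℝ) :
    Measurable (B.priceOr t τ c) := by
  refine measurable_of_countable_fibers hτ.measurableSet_eq
    (fun k => WithTop.recTopCoe (C := fun _ => Ω → ℝ) (fun _ => c)
      (fun n ω => if 0 < B.remaining t (n + 1) ω then B.offer n ω else c) k) ?_ fun ω => ?_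
  · intro k
    induction k using WithTop.recTopCoe with
    | top => exact measurable_const
    | coe n =>
      exact Measurable.ite (measurableSet_lt measurable_const (B.measurable_remaining t (n + 1)))
        (B.measurable_offer n) measurable_const
  · cases h : τ ω with
    | top => exact B.priceOr_of_eq_top h
    | coe n => exact B.priceOr_of_eq_coe h

variable (B τ) in
/-- The event that no offer is accepted before the deadline. -/
def unsold (t : ℝ) : Set Ω :=
  {ω | ∃ n : ℕ, τ ω = (n : WithTop ℕ) ∧ 0 < B.remaining t (n + 1) ω}ᶜ

lemma IsPolicy.measurableSet_unsold (hτ : B.IsPolicy τ) (t : ℝ) :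
    MeasurableSet[MeasurableSpace.comap (fun ω (i : ℕ) => (B.wait i ω, B.offer i ω)) inferInstance]
      (B.unsold τ t) := by
  have hle : ∀ n, B.history n ≤
      MeasurableSpace.comap (fun ω (i : ℕ) => (B.wait i ω, B.offer i ω)) inferInstance := by
    intro n
    refine iSup₂_le fun i _ => ?_
    rintro _ ⟨s, hs, rfl⟩
    exact ⟨(fun x : ℕ → ℝ × ℝ => x i) ⁻¹' s, measurable_pi_apply i hs, rfl⟩
  have h : {ω | ∃ n : ℕ, τ ω = (n : WithTop ℕ) ∧ 0 < B.remaining t (n + 1) ω} =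
      ⋃ n : ℕ, {ω | τ ω = n} ∩ B.remaining t (n + 1) ⁻¹' Ioi 0 := by
    ext ω
    simp
  rw [unsold, h]
  exact (MeasurableSet.iUnion fun n => hle n _ ((hτ.measurableSet_eq_coe n).inter
    (B.measurable_remaining_past t (n + 1) measurableSet_Ioi))).compl

lemma salePrice_eq_add (t c : ℝ) : B.salePrice t τ =
    fun ω => B.priceOr t τ c ω + (B.salvage ω - c) * (B.unsold τ t).indicator 1 ω := by
  ext ω
  rw [salePrice_eq_priceOr]
  by_cases h : ∃ n : ℕ, τ ω = (n : WithTop ℕ) ∧ 0 < B.remaining t (n + 1) ω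
  · rw [indicator_of_notMem (show ω ∉ B.unsold τ t from fun h' => h' h)]
    simp [priceOr, dif_pos h]
  · rw [indicator_of_mem (show ω ∈ B.unsold τ t from h)]
    simp [priceOr, dif_neg h]

section Salvage

variable [IsProbabilityMeasure P]

/-- The salvage value is independent of whether the asset is sold in time, so in expectation it may
be replaced by its mean. -/
lemma IsPolicy.salvage_correction (hτ : B.IsPolicy τ) (hν₀ : Integrable (fun x : ℝ => x) ν₀)
    (t : ℝ) :
    Integrable (fun ω => (B.salvage ω - meanSalvage ν₀) * (B.unsold τ t).indicator 1 ω) P ∧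
      ∫ ω, (B.salvage ω - meanSalvage ν₀) * (B.unsold τ t).indicator 1 ω ∂P = 0 := by
  obtain ⟨s, hs, hsu⟩ := hτ.measurableSet_unsold t
  have hmu : MeasurableSet (B.unsold τ t) :=
    (measurable_pi_lambda _ fun i => (B.measurable_wait i).prodMk (B.measurable_offer i)).comap_le
      _ (hτ.measurableSet_unsold t)
  have hsal : Integrable B.salvage P := by
    rw [← B.hasLaw_salvage.map_eq] at hν₀
    exact hν₀.comp_measurable B.measurable_salvage
  have hint : Integrable (fun ω => B.salvage ω - meanSalvage ν₀) P :=
    hsal.sub (integrable_const _)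
  have hind : IndepFun (fun ω => B.salvage ω - meanSalvage ν₀)
      ((B.unsold τ t).indicator (1 : Ω → ℝ)) P := by
    have h := B.indepFun_salvage.comp (φ := fun x => x - meanSalvage ν₀)
      (ψ := s.indicator (1 : (ℕ → ℝ × ℝ) → ℝ)) (by fun_prop) (measurable_one.indicator hs)
    rw [← hsu]
    exact h
  have hmean : ∫ ω, B.salvage ω ∂P = meanSalvage ν₀ := B.hasLaw_salvage.integral_eq
  refine ⟨?_, ?_⟩
  · have h : (fun ω => (B.salvage ω - meanSalvage ν₀) * (B.unsold τ t).indicator 1 ω) =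
        (B.unsold τ t).indicator fun ω => B.salvage ω - meanSalvage ν₀ := by
      ext ω
      by_cases hω : ω ∈ B.unsold τ t <;> simp [hω]
    rw [h]
    exact hint.indicator hmu
  · rw [hind.integral_fun_mul_eq_mul_integral hint.aestronglyMeasurable
      (measurable_one.indicator hmu).aestronglyMeasurable, integral_sub hsal (integrable_const _),
      hmean]
    simp

lemma IsPolicy.integrable_salePrice_iff (hτ : B.IsPolicy τ)
    (hν₀ : Integrable (fun x : ℝ => x) ν₀) (t : ℝ) :
    Integrable (B.salePrice t τ) P ↔ Integrable (B.priceOr t τ (meanSalvage ν₀)) P := by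
  rw [salePrice_eq_add t (meanSalvage ν₀)]
  exact integrable_add_iff_integrable_left (hτ.salvage_correction hν₀ t).1

lemma IsPolicy.integral_salePrice (hτ : B.IsPolicy τ) (hν₀ : Integrable (fun x : ℝ => x) ν₀)
    {t : ℝ} (hint : Integrable (B.priceOr t τ (meanSalvage ν₀)) P) :
    ∫ ω, B.salePrice t τ ω ∂P = ∫ ω, B.priceOr t τ (meanSalvage ν₀) ω ∂P := by
  rw [salePrice_eq_add t (meanSalvage ν₀)]
  rw [integral_add hint (hτ.salvage_correction hν₀ t).1, (hτ.salvage_correction hν₀ t).2, add_zero]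

end Salvage

/-! ### The supermartingale of a policy -/

open Classical in
variable (B τ) in
/-- The seller's position just before offer `n`: the threshold `m` at the remaining time while the
asset is unsold, and the positive part of the price once an offer has been accepted. -/
noncomputable def position (m : ℝ → ℝ) (t : ℝ) (n : ℕ) (ω : Ω) : ℝ :=
  if (n : WithTop ℕ) ≤ τ ω then m (B.remaining t n ω) else max (B.priceOr t τ (m 0) ω) 0

open Classical in
variable (B τ) in
/-- The seller's position on the arrival of offer `n`, before deciding on it. -/
noncomputable def positionAtOffer (m : ℝ → ℝ) (t : ℝ) (n : ℕ) (ω : Ω) : ℝ :=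
  if (n : WithTop ℕ) ≤ τ ω then offerValue m (B.remaining t (n + 1) ω) (B.offer n ω)
  else max (B.priceOr t τ (m 0) ω) 0

variable {m : ℝ → ℝ} {t : ℝ}

/-- Deciding on an offer does not improve the position. -/
lemma position_succ_le (hm : Monotone m) (hm0 : 0 ≤ m 0) (ht : 0 ≤ t) (n : ℕ) (ω : Ω) :
    B.position τ m t (n + 1) ω ≤ B.positionAtOffer τ m t n ω := by
  unfold position positionAtOffer
  by_cases h : (n : WithTop ℕ) ≤ τ ω
  · rw [if_pos h]
    rcases coe_succ_le_or h with h1 | h1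
    · rw [if_pos h1]
      exact le_offerValue hm _ _
    · rw [h1, if_neg (not_coe_succ_le n), B.priceOr_of_eq_coe h1]
      refine max_le ?_ (offerValue_nonneg hm hm0 (B.remaining_nonneg ht _ _) _)
      unfold offerValue
      split_ifs
      · exact le_max_left _ _
      · exact le_rfl
  · rw [if_neg h, if_neg fun h' => h (coe_succ_le_iff.1 h').le]

/-- A policy that accepts exactly the offers above the threshold keeps its position. -/
lemma position_succ_eq (hm : Monotone m) (hm0 : 0 ≤ m 0) (ht : 0 ≤ t) {n : ℕ} {ω : Ω}
    (hacc : τ ω = n → m (B.remaining t (n + 1) ω) ≤ B.offer n ω)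
    (hrej : ((n + 1 : ℕ) : WithTop ℕ) ≤ τ ω → B.offer n ω < m (B.remaining t (n + 1) ω)) :
    B.position τ m t (n + 1) ω = B.positionAtOffer τ m t n ω := by
  have hR := B.remaining_nonneg ht (n + 1) ω
  unfold position positionAtOffer
  by_cases h : (n : WithTop ℕ) ≤ τ ω
  · rw [if_pos h]
    rcases coe_succ_le_or h with h1 | h1
    · rw [if_pos h1]
      unfold offerValue
      split_ifs with hpos
      · exact (max_eq_right (hrej h1).le).symm
      · rw [le_antisymm (not_lt.1 hpos) hR]
    · rw [h1, if_neg (not_coe_succ_le n), B.priceOr_of_eq_coe h1]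
      unfold offerValue
      split_ifs with hpos
      · rw [max_eq_left (hacc h1), max_eq_left ((hm0.trans (hm hR)).trans (hacc h1))]
      · exact max_eq_left hm0
  · rw [if_neg h, if_neg fun h' => h (coe_succ_le_iff.1 h').le]

section Limit

variable [IsProbabilityMeasure P] [IsProbabilityMeasure ν]

/-- The arrival of an offer does not change the expected position. -/
lemma IsPolicy.lintegral_positionAtOffer (hτ : B.IsPolicy τ) (hr : 0 < r)
    (hm : IsBellmanSolution ν r m) (ht : 0 ≤ t) (n : ℕ) :
    ∫⁻ ω, ENNReal.ofReal (B.positionAtOffer τ m t n ω) ∂P =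
      ∫⁻ ω, ENNReal.ofReal (B.position τ m t n ω) ∂P := by
  set A := {ω | (n : WithTop ℕ) ≤ τ ω} with hA
  have hAp : MeasurableSet[B.past n] A := hτ.measurableSet_le n
  have hAm : MeasurableSet A := B.past_le n _ hAp
  rw [← lintegral_add_compl _ hAm,
    ← lintegral_add_compl (fun ω => ENNReal.ofReal (B.position τ m t n ω)) hAm]
  congr 1
  · -- while the asset is unsold, the arrival is integrated out with the remaining time and the
    -- event `A` held fixed, and the Bellman equation applies
    have hU : Measurable[B.past n] fun ω => (B.remaining t n ω, A.indicator (1 : Ω → ENNReal) ω) :=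
      (B.measurable_remaining_past t n).prodMk
        (@Measurable.indicator _ _ (_) _ _ _ _ (@measurable_const _ _ _ (_) 1) hAp)
    have hv : Measurable fun p : (ℝ × ENNReal) × (ℝ × ℝ) =>
        p.1.2 * ENNReal.ofReal (offerValue m (max (p.1.1 - p.2.1) 0) p.2.2) :=
      (by fun_prop : Measurable fun p : (ℝ × ENNReal) × (ℝ × ℝ) => p.1.2).mul
        ((measurable_offerValue hm.monotone.measurable).comp
          (f := fun p : (ℝ × ENNReal) × (ℝ × ℝ) => (max (p.1.1 - p.2.1) 0, p.2.2))
          (by fun_prop)).ennreal_ofReal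
    have key := B.lintegral_past_arrival hr hU hv
    calc _ = ∫⁻ ω, A.indicator (1 : Ω → ENNReal) ω *
          ENNReal.ofReal
            (offerValue m (max (B.remaining t n ω - B.wait n ω) 0) (B.offer n ω)) ∂P := by
          rw [← lintegral_indicator hAm]
          refine lintegral_congr fun ω => ?_
          by_cases hω : ω ∈ A
          · simp only [indicator_of_mem hω, Pi.one_apply, one_mul, positionAtOffer]
            rw [if_pos (show (n : WithTop ℕ) ≤ τ ω from hω)]
            rfl
          · simp [indicator_of_notMem hω]
      _ = _ := key
      _ = ∫⁻ ω, A.indicator (1 : Ω → ENNReal) ω * ENNReal.ofReal (m (B.remaining t n ω)) ∂P := by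
          refine lintegral_congr fun ω => ?_
          have hmeas : Measurable fun z : ℝ × ℝ =>
              ENNReal.ofReal (offerValue m (max (B.remaining t n ω - z.1) 0) z.2) :=
            ((measurable_offerValue hm.monotone.measurable).comp
              (f := fun z : ℝ × ℝ => (max (B.remaining t n ω - z.1) 0, z.2))
              (by fun_prop)).ennreal_ofReal
          rw [lintegral_const_mul _ hmeas, hm.lintegral_eq (B.remaining_nonneg ht n ω)]
      _ = _ := by
          rw [← lintegral_indicator hAm]
          refine lintegral_congr fun ω => ?_
          by_cases hω : ω ∈ A
          · simp only [indicator_of_mem hω, Pi.one_apply, one_mul, position]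
            rw [if_pos (show (n : WithTop ℕ) ≤ τ ω from hω)]
          · simp [indicator_of_notMem hω]
  · refine setLIntegral_congr_fun hAm.compl fun ω hω => ?_
    simp only [position, positionAtOffer]
    have hω' : ¬ (n : WithTop ℕ) ≤ τ ω := hω
    rw [if_neg hω', if_neg hω']

omit [IsProbabilityMeasure P] [IsProbabilityMeasure ν] in
lemma position_zero (ω : Ω) : B.position τ m t 0 ω = m t := if_pos (by simp)

/-- The position is a supermartingale with initial value `m t`. -/
lemma IsPolicy.lintegral_position_le (hτ : B.IsPolicy τ) (hr : 0 < r)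
    (hm : IsBellmanSolution ν r m) (ht : 0 ≤ t) (n : ℕ) :
    ∫⁻ ω, ENNReal.ofReal (B.position τ m t n ω) ∂P ≤ ENNReal.ofReal (m t) := by
  induction n with
  | zero => simp [position_zero]
  | succ n ih =>
    calc _ ≤ ∫⁻ ω, ENNReal.ofReal (B.positionAtOffer τ m t n ω) ∂P :=
          lintegral_mono fun ω =>
            ENNReal.ofReal_le_ofReal (position_succ_le hm.monotone hm.nonneg ht n ω)
      _ ≤ _ := (hτ.lintegral_positionAtOffer hr hm ht n).trans_le ih

omit [IsProbabilityMeasure P] [IsProbabilityMeasure ν] in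
lemma IsPolicy.measurable_position (hτ : B.IsPolicy τ) (hm : Monotone m) (n : ℕ) :
    Measurable (B.position τ m t n) :=
  Measurable.ite (B.past_le n _ (hτ.measurableSet_le n))
    (hm.measurable.comp (B.measurable_remaining t n))
    ((hτ.measurable_priceOr t _).max measurable_const)

/-- The position settles at the positive part of the price after finitely many offers. -/
lemma ae_eventually_position_eq (hr : 0 < r) (hm0 : 0 ≤ m 0) (ht : 0 ≤ t) :
    ∀ᵐ ω ∂P, ∀ᶠ n in atTop, B.position τ m t n ω = max (B.priceOr t τ (m 0) ω) 0 := by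
  filter_upwards [B.ae_eventually_remaining_eq_zero hr ht] with ω hω
  cases h : τ ω with
  | top =>
    filter_upwards [hω] with n hn
    rw [position, if_pos (h ▸ le_top), B.priceOr_of_eq_top h, hn, max_eq_left hm0]
  | coe k =>
    filter_upwards [eventually_gt_atTop k] with n hn
    rw [position, if_neg]
    rw [h, not_le]
    exact Nat.cast_lt (α := WithTop ℕ).2 hn

/-- The expected positive part of the price is at most `m t`, by Fatou's lemma. -/
lemma IsPolicy.lintegral_posPart_priceOr_le (hτ : B.IsPolicy τ) (hr : 0 < r)
    (hm : IsBellmanSolution ν r m) (ht : 0 ≤ t) :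
    ∫⁻ ω, ENNReal.ofReal (max (B.priceOr t τ (m 0) ω) 0) ∂P ≤ ENNReal.ofReal (m t) := by
  calc _ = ∫⁻ ω, liminf (fun n => ENNReal.ofReal (B.position τ m t n ω)) atTop ∂P := by
        refine lintegral_congr_ae ?_
        filter_upwards [ae_eventually_position_eq (B := B) (τ := τ) hr hm.nonneg ht] with ω hω
        refine (Tendsto.liminf_eq (tendsto_const_nhds.congr' ?_)).symm
        filter_upwards [hω] with n hn
        rw [hn]
    _ ≤ liminf (fun n => ∫⁻ ω, ENNReal.ofReal (B.position τ m t n ω) ∂P) atTop :=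
        lintegral_liminf_le fun n => (hτ.measurable_position hm.monotone n).ennreal_ofReal
    _ ≤ liminf (fun _ : ℕ => ENNReal.ofReal (m t)) atTop :=
        liminf_le_liminf (Eventually.of_forall fun n => hτ.lintegral_position_le hr hm ht n)
    _ = _ := liminf_const _

lemma IsPolicy.integrable_posPart_priceOr (hτ : B.IsPolicy τ) (hr : 0 < r)
    (hm : IsBellmanSolution ν r m) (ht : 0 ≤ t) :
    Integrable (fun ω => max (B.priceOr t τ (m 0) ω) 0) P := by
  refine ⟨((hτ.measurable_priceOr t _).max measurable_const).aestronglyMeasurable, ?_⟩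
  rw [hasFiniteIntegral_iff_ofReal (f := fun ω => max (B.priceOr t τ (m 0) ω) 0)
    (ae_of_all _ fun ω => le_max_right _ _)]
  exact (hτ.lintegral_posPart_priceOr_le hr hm ht).trans_lt ENNReal.ofReal_lt_top

lemma IsPolicy.integral_priceOr_le (hτ : B.IsPolicy τ) (hr : 0 < r)
    (hm : IsBellmanSolution ν r m) (ht : 0 ≤ t) (hint : Integrable (B.priceOr t τ (m 0)) P) :
    ∫ ω, B.priceOr t τ (m 0) ω ∂P ≤ m t := by
  have hpos := hτ.integrable_posPart_priceOr hr hm ht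
  calc _ ≤ ∫ ω, max (B.priceOr t τ (m 0) ω) 0 ∂P :=
        integral_mono hint hpos fun ω => le_max_left _ _
    _ ≤ m t := by
        rw [integral_eq_lintegral_of_nonneg_ae (f := fun ω => max (B.priceOr t τ (m 0) ω) 0)
          (ae_of_all _ fun ω => le_max_right _ _) hpos.1]
        exact ENNReal.toReal_le_of_le_ofReal (hm.nonneg.trans (hm.monotone ht))
          (hτ.lintegral_posPart_priceOr_le hr hm ht)

/-! ### The threshold policy -/

omit [IsProbabilityMeasure P] [IsProbabilityMeasure ν] in
lemma isPolicy_thresholdPolicy (hm : Measurable m) (t : ℝ) :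
    B.IsPolicy (B.thresholdPolicy m t) := by
  intro n
  have h : {ω | B.thresholdPolicy m t ω ≤ WithTop.some n} =
      ⋃ k ≤ n, {ω | m (B.remaining t (k + 1) ω) ≤ B.offer k ω} := by
    ext ω
    simp only [thresholdPolicy, mem_ofPred_eq, mem_iUnion, exists_prop]
    split_ifs with hex
    · exact (Nat.cast_le (α := WithTop ℕ)).trans (Nat.find_le_iff hex n)
    · refine iff_of_false (WithTop.coe_lt_top n).not_ge ?_
      rintro ⟨k, _, hk⟩
      exact hex ⟨k, hk⟩
  rw [h]
  refine MeasurableSet.iUnion fun k => MeasurableSet.iUnion fun hk => ?_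
  have h1 : Measurable[B.history n] (B.remaining t (k + 1)) :=
    (B.measurable_remaining_past t (k + 1)).mono (B.history.mono hk) le_rfl
  exact measurableSet_le (hm.comp h1) (B.measurable_arrival hk).snd

omit [IsProbabilityMeasure P] [IsProbabilityMeasure ν] in
/-- Only the threshold at nonnegative times matters. -/
lemma thresholdPolicy_congr {m' : ℝ → ℝ} (ht : 0 ≤ t) (h : ∀ s, 0 ≤ s → m s = m' s) :
    B.thresholdPolicy m t = B.thresholdPolicy m' t := by
  ext ω : 1
  have hp : (fun n => m (B.remaining t (n + 1) ω) ≤ B.offer n ω) =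
      fun n => m' (B.remaining t (n + 1) ω) ≤ B.offer n ω :=
    funext fun n => by rw [h _ (B.remaining_nonneg ht (n + 1) ω)]
  unfold thresholdPolicy
  by_cases hex : ∃ n, m (B.remaining t (n + 1) ω) ≤ B.offer n ω
  · have hex' : ∃ n, m' (B.remaining t (n + 1) ω) ≤ B.offer n ω := hp ▸ hex
    rw [dif_pos hex, dif_pos hex', Nat.find_congr' fun {n} => iff_of_eq (congrFun hp n)]
  · have hex' : ¬ ∃ n, m' (B.remaining t (n + 1) ω) ≤ B.offer n ω := hp ▸ hex
    rw [dif_neg hex, dif_neg hex']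

omit [IsProbabilityMeasure P] [IsProbabilityMeasure ν] in
lemma offer_ge_of_thresholdPolicy_eq {n : ℕ} {ω : Ω} (h : B.thresholdPolicy m t ω = n) :
    m (B.remaining t (n + 1) ω) ≤ B.offer n ω := by
  unfold thresholdPolicy at h
  split_ifs at h with hex
  · rw [← Nat.cast_injective h]
    exact Nat.find_spec hex
  · exact absurd h WithTop.top_ne_coe

omit [IsProbabilityMeasure P] [IsProbabilityMeasure ν] in
lemma offer_lt_of_succ_le_thresholdPolicy {n : ℕ} {ω : Ω}
    (h : ((n + 1 : ℕ) : WithTop ℕ) ≤ B.thresholdPolicy m t ω) :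
    B.offer n ω < m (B.remaining t (n + 1) ω) := by
  unfold thresholdPolicy at h
  split_ifs at h with hex
  · exact not_le.1 (Nat.find_min hex (Nat.cast_le (α := WithTop ℕ).1 h))
  · by_contra hn
    exact hex ⟨n, not_lt.1 hn⟩

omit [IsProbabilityMeasure P] [IsProbabilityMeasure ν] in
lemma priceOr_thresholdPolicy_nonneg (hm : Monotone m) (hm0 : 0 ≤ m 0) (ht : 0 ≤ t) (ω : Ω) :
    0 ≤ B.priceOr t (B.thresholdPolicy m t) (m 0) ω := by
  cases h : B.thresholdPolicy m t ω with
  | top => rwa [B.priceOr_of_eq_top h]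
  | coe n =>
    rw [B.priceOr_of_eq_coe h]
    split_ifs
    · exact (hm0.trans (hm (B.remaining_nonneg ht _ _))).trans (offer_ge_of_thresholdPolicy_eq h)
    · exact hm0

/-- Under the threshold policy the position is a martingale with initial value `m t`. -/
lemma lintegral_position_thresholdPolicy (hr : 0 < r) (hm : IsBellmanSolution ν r m) (ht : 0 ≤ t)
    (n : ℕ) :
    ∫⁻ ω, ENNReal.ofReal (B.position (B.thresholdPolicy m t) m t n ω) ∂P =
      ENNReal.ofReal (m t) := by
  induction n with
  | zero => simp [position_zero]
  | succ n ih =>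
    rw [← ih, ← (isPolicy_thresholdPolicy hm.monotone.measurable t).lintegral_positionAtOffer
      hr hm ht n]
    refine lintegral_congr fun ω => ?_
    rw [position_succ_eq hm.monotone hm.nonneg ht offer_ge_of_thresholdPolicy_eq
      offer_lt_of_succ_le_thresholdPolicy]

/-- The threshold policy is worth `m t`. Its position is a martingale, and it is dominated by the
price plus `m t`, where the price is nonnegative and, by Fatou's lemma, integrable. -/
lemma integral_priceOr_thresholdPolicy (hr : 0 < r) (hm : IsBellmanSolution ν r m) (ht : 0 ≤ t) :
    Integrable (B.priceOr t (B.thresholdPolicy m t) (m 0)) P ∧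
      ∫ ω, B.priceOr t (B.thresholdPolicy m t) (m 0) ω ∂P = m t := by
  set τ := B.thresholdPolicy m t with hτdef
  have hτ : B.IsPolicy τ := isPolicy_thresholdPolicy hm.monotone.measurable t
  have hnn : ∀ ω, 0 ≤ B.priceOr t τ (m 0) ω :=
    priceOr_thresholdPolicy_nonneg hm.monotone hm.nonneg ht
  have hmax : (fun ω => max (B.priceOr t τ (m 0) ω) 0) = B.priceOr t τ (m 0) :=
    funext fun ω => max_eq_left (hnn ω)
  have hint : Integrable (B.priceOr t τ (m 0)) P :=
    hmax ▸ hτ.integrable_posPart_priceOr hr hm ht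
  have hmt : 0 ≤ m t := hm.nonneg.trans (hm.monotone ht)
  have hlim : Tendsto (fun n => ∫⁻ ω, ENNReal.ofReal (B.position τ m t n ω) ∂P) atTop
      (𝓝 (∫⁻ ω, ENNReal.ofReal (B.priceOr t τ (m 0) ω) ∂P)) := by
    refine tendsto_lintegral_of_dominated_convergence
      (fun ω => ENNReal.ofReal (B.priceOr t τ (m 0) ω + m t))
      (fun n => (hτ.measurable_position hm.monotone n).ennreal_ofReal) (fun n => ?_)
      (hint.add (integrable_const (m t))).lintegral_lt_top.ne ?_
    · filter_upwards [B.ae_wait_pos] with ω hω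
      refine ENNReal.ofReal_le_ofReal ?_
      unfold position
      split_ifs
      · have := hm.monotone (B.antitone_remaining ht hω (Nat.zero_le n))
        exact this.trans (le_add_of_nonneg_left (hnn ω))
      · rw [max_eq_left (hnn ω)]
        exact le_add_of_nonneg_right hmt
    · filter_upwards [ae_eventually_position_eq (B := B) (τ := τ) hr hm.nonneg ht] with ω hω
      refine tendsto_const_nhds.congr' ?_
      filter_upwards [hω] with n hn
      rw [hn, max_eq_left (hnn ω)]
  refine ⟨hint, ?_⟩
  simp_rw [hτdef, lintegral_position_thresholdPolicy hr hm ht] at hlim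
  rw [integral_eq_lintegral_of_nonneg_ae (ae_of_all _ hnn) hint.1,
    ← tendsto_nhds_unique tendsto_const_nhds hlim, ENNReal.toReal_ofReal hmt]

/-! ### The value function -/

section Value

variable (hr : 0 < r) (hm : IsBellmanSolution ν r m) (hν₀ : Integrable (fun x : ℝ => x) ν₀)
  (hm0 : m 0 = meanSalvage ν₀)
include hr hm hν₀ hm0

lemma IsPolicy.integrable_posPart_salePrice (hτ : B.IsPolicy τ) (ht : 0 ≤ t) :
    Integrable (fun ω => max (B.salePrice t τ ω) 0) P := by
  have h1 := hτ.integrable_posPart_priceOr hr hm ht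
  have h2 := (hτ.salvage_correction hν₀ t).1
  have hmeas : AEStronglyMeasurable (B.salePrice t τ) P := by
    rw [salePrice_eq_add t (meanSalvage ν₀)]
    exact (hτ.measurable_priceOr t _).aestronglyMeasurable.add h2.1
  refine (h1.add h2.abs).mono' (hmeas.sup aestronglyMeasurable_const) (ae_of_all _ fun ω => ?_)
  rw [Real.norm_of_nonneg (le_max_right _ _), salePrice_eq_add t (meanSalvage ν₀), ← hm0]
  refine max_le ?_ (add_nonneg (le_max_right _ _) (abs_nonneg _))
  exact add_le_add (le_max_left _ _) (le_abs_self _)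

lemma integral_salePrice_thresholdPolicy (ht : 0 ≤ t) :
    Integrable (B.salePrice t (B.thresholdPolicy m t)) P ∧
      ∫ ω, B.salePrice t (B.thresholdPolicy m t) ω ∂P = m t := by
  have hτ : B.IsPolicy (B.thresholdPolicy m t) := isPolicy_thresholdPolicy hm.monotone.measurable t
  obtain ⟨h1, h2⟩ := integral_priceOr_thresholdPolicy (B := B) hr hm ht
  rw [hm0] at h1 h2
  exact ⟨(hτ.integrable_salePrice_iff hν₀ t).2 h1, (hτ.integral_salePrice hν₀ h1).trans h2⟩

lemma isGreatest_achievable (ht : 0 ≤ t) : IsGreatest (B.achievable t) (m t) := by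
  refine ⟨⟨_, isPolicy_thresholdPolicy hm.monotone.measurable t,
    integral_salePrice_thresholdPolicy hr hm hν₀ hm0 ht⟩, ?_⟩
  rintro _ ⟨τ, hτ, hint, rfl⟩
  have h := (hτ.integrable_salePrice_iff hν₀ t).1 hint
  rw [hτ.integral_salePrice hν₀ h, ← hm0]
  exact hτ.integral_priceOr_le hr hm ht (hm0.symm ▸ h)

lemma value_eq_offerValue (ht : 0 ≤ t) (x : ℝ) : B.value t x = offerValue m t x := by
  unfold value offerValue
  split_ifs
  · exact ((isGreatest_achievable hr hm hν₀ hm0 ht).insert x).csSup_eq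
  · exact hm0.symm

lemma optimalThreshold_eq (ht : 0 ≤ t) : B.optimalThreshold t = m t := by
  unfold optimalThreshold
  simp_rw [value_eq_offerValue (B := B) hr hm hν₀ hm0 (le_max_right _ _)]
  exact hm.integral_eq t ht

end Value

end Limit

end BiddingProcess

/-! ### The optimal threshold -/

/-- The threshold function of the selling problem: the solution of `y' = r φ(y)`, `y(0) = μ₀`. -/
noncomputable def threshold (ν ν₀ : Measure ℝ) (r : ℝ) : ℝ → ℝ :=
  flow (phi ν) (meanSalvage ν₀) r

lemma priceRange_eq {ν ν₀ : Measure ℝ} [IsProbabilityMeasure ν]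
    (hν : Integrable (fun x : ℝ => max x 0) ν) :
    priceRange ν ν₀ = {x | meanSalvage ν₀ ≤ x ∧ 0 < phi ν x} := by
  ext x
  exact and_congr_right fun _ => (phi_pos_iff_lt_maxOffer hν).symm

lemma isBellmanSolution_threshold {ν ν₀ : Measure ℝ} [IsProbabilityMeasure ν] {r : ℝ} (hr : 0 < r)
    (hν : Integrable (fun x : ℝ => max x 0) ν) (hμ₀ : 0 ≤ meanSalvage ν₀)
    (hM : 0 < phi ν (meanSalvage ν₀)) : IsBellmanSolution ν r (threshold ν ν₀ r) := by
  have hL := lipschitzWith_phi hν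
  have hA := antitone_phi hν
  have hlim := tendsto_phi_atTop hν
  have hmono : Monotone (threshold ν ν₀ r) := monotone_flow hL hA hlim hM hr
  have h0 : 0 ≤ threshold ν ν₀ r 0 := hμ₀.trans_eq (flow_zero hL hA hlim hM hr).symm
  exact ⟨hmono, h0, integrable_offerValue hν hr hmono h0,
    bellman hν hr hmono h0 (continuous_flow hL hA hlim hM hr)
      fun t ht => hasDerivWithinAt_flow hL hA hlim hM hr ht⟩

end CayleyMoser

theorem mainTheorem1 {Ω : Type*} [MeasurableSpace Ω] (P : Measure Ω) [IsProbabilityMeasure P]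
    (r : ℝ) (hr : 0 < r)
    (ν ν₀ : Measure ℝ) [IsProbabilityMeasure ν] [IsProbabilityMeasure ν₀]
    (hν : Integrable (fun x : ℝ => max x 0) ν)
    (hν₀ : Integrable (fun x : ℝ => x) ν₀)
    (hμ₀ : 0 ≤ CayleyMoser.meanSalvage ν₀)
    (hM : (CayleyMoser.meanSalvage ν₀ : EReal) < CayleyMoser.maxOffer ν)
    (B : CayleyMoser.BiddingProcess P r ν ν₀) :
    -- every policy has a well-defined expected sale price in `[-∞, ∞)`
    (∀ t : ℝ, 0 ≤ t → ∀ τ : Ω → WithTop ℕ, B.IsPolicy τ →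
      Integrable (fun ω => max (B.salePrice t τ ω) 0) P) ∧
    -- the expectation that defines `μ(t)` exists
    (∀ t : ℝ, 0 ≤ t → Integrable (fun z : ℝ × ℝ => B.value (max (t - z.1) 0) z.2)
      ((expMeasure r).prod ν)) ∧
    -- `V(t, x)` is an attained maximum, and `V(t, x) = max (x, μ(t))`
    (∀ t : ℝ, 0 < t → ∀ x : ℝ,
      IsGreatest (insert x (B.achievable t)) (B.value t x) ∧
      B.value t x = max x (B.optimalThreshold t)) ∧
    -- the threshold policy given by `μ` is optimal, with expected sale price `μ(t)`
    (∀ t : ℝ, 0 ≤ t →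
      B.IsPolicy (B.thresholdPolicy B.optimalThreshold t) ∧
      Integrable (B.salePrice t (B.thresholdPolicy B.optimalThreshold t)) P ∧
      ∫ ω, B.salePrice t (B.thresholdPolicy B.optimalThreshold t) ω ∂P = B.optimalThreshold t ∧
      IsGreatest (B.achievable t) (B.optimalThreshold t)) ∧
    -- `φ(x) = E[(X - x)₊]`
    (∀ x : ℝ, IntegrableOn (fun u : ℝ => 1 - cdf ν u) (Ioi x) ∧
      Integrable (fun u : ℝ => max (u - x) 0) ν ∧
      CayleyMoser.phi ν x = ∫ u, max (u - x) 0 ∂ν) ∧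
    -- `μ` is the solution of the initial value problem
    B.optimalThreshold 0 = CayleyMoser.meanSalvage ν₀ ∧
    (∀ t : ℝ, 0 ≤ t → HasDerivWithinAt B.optimalThreshold
      (r * CayleyMoser.phi ν (B.optimalThreshold t)) (Ici 0) t) ∧
    (∀ y : ℝ → ℝ, y 0 = CayleyMoser.meanSalvage ν₀ →
      (∀ t : ℝ, 0 ≤ t → HasDerivWithinAt y (r * CayleyMoser.phi ν (y t)) (Ici 0) t) →
      ∀ t : ℝ, 0 ≤ t → y t = B.optimalThreshold t) ∧
    -- `Ψ` is well defined on `[μ₀, M)`, maps it bijectively onto `[0, ∞)`, and `μ(t) = Ψ⁻¹(r t)`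
    (∀ x ∈ CayleyMoser.priceRange ν ν₀, 0 < CayleyMoser.phi ν x ∧
      IntervalIntegrable (fun u : ℝ => 1 / CayleyMoser.phi ν u) volume
        (CayleyMoser.meanSalvage ν₀) x) ∧
    BijOn (CayleyMoser.psi ν ν₀) (CayleyMoser.priceRange ν ν₀) (Ici 0) ∧
    (∀ t : ℝ, 0 ≤ t → B.optimalThreshold t =
      Function.invFunOn (CayleyMoser.psi ν ν₀) (CayleyMoser.priceRange ν ν₀) (r * t)) := by
  have hL := CayleyMoser.lipschitzWith_phi hν
  have hA := CayleyMoser.antitone_phi hν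
  have hlim := CayleyMoser.tendsto_phi_atTop hν
  have ha := (CayleyMoser.phi_pos_iff_lt_maxOffer hν).2 hM
  have hm := CayleyMoser.isBellmanSolution_threshold hr hν hμ₀ ha
  have hm0 : CayleyMoser.threshold ν ν₀ r 0 = CayleyMoser.meanSalvage ν₀ :=
    CayleyMoser.flow_zero hL hA hlim ha hr
  have hopt : ∀ t, 0 ≤ t → B.optimalThreshold t = CayleyMoser.threshold ν ν₀ r t :=
    fun t ht => CayleyMoser.BiddingProcess.optimalThreshold_eq hr hm hν₀ hm0 ht
  have hpol : ∀ t, 0 ≤ t → B.thresholdPolicy B.optimalThreshold t =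
      B.thresholdPolicy (CayleyMoser.threshold ν ν₀ r) t := fun t ht =>
    CayleyMoser.BiddingProcess.thresholdPolicy_congr ht hopt
  have hval : ∀ t, 0 ≤ t → ∀ x, B.value t x =
      CayleyMoser.offerValue (CayleyMoser.threshold ν ν₀ r) t x :=
    fun t ht x => CayleyMoser.BiddingProcess.value_eq_offerValue hr hm hν₀ hm0 ht x
  have hgr : ∀ t, 0 ≤ t → IsGreatest (B.achievable t) (CayleyMoser.threshold ν ν₀ r t) :=
    fun t ht => CayleyMoser.BiddingProcess.isGreatest_achievable hr hm hν₀ hm0 ht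
  have hderiv : ∀ t : ℝ, 0 ≤ t → HasDerivWithinAt B.optimalThreshold
      (r * CayleyMoser.phi ν (B.optimalThreshold t)) (Ici 0) t := fun t ht => by
    rw [hopt t ht]
    exact (CayleyMoser.hasDerivWithinAt_flow hL hA hlim ha hr ht).congr_of_mem
      (fun s hs => hopt s hs) ht
  refine ⟨fun t ht τ hτ => hτ.integrable_posPart_salePrice hr hm hν₀ hm0 ht, fun t ht => ?_,
    fun t ht x => ?_, fun t ht => ?_,
    fun x => ⟨CayleyMoser.integrableOn_one_sub_cdf hν x, CayleyMoser.integrable_sub_posPart hν x,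
      CayleyMoser.phi_eq_integral_posPart x⟩, (hopt 0 le_rfl).trans hm0, hderiv,
    fun y hy0 hy t ht => CayleyMoser.eq_of_hasDerivWithinAt_Ici hL hy hderiv
      (hy0.trans (hm0.symm.trans (hopt 0 le_rfl).symm)) ht, fun x hx => ?_, ?_, fun t ht => ?_⟩
  · simp_rw [hval _ (le_max_right _ _)]
    exact hm.integrable t ht
  · have hv : B.value t x = max x (CayleyMoser.threshold ν ν₀ r t) := by
      rw [hval t ht.le, CayleyMoser.offerValue, if_pos ht]
    refine ⟨hv ▸ (hgr t ht.le).insert x, ?_⟩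
    rw [hv, hopt t ht.le]
  · rw [hpol t ht, hopt t ht]
    obtain ⟨h1, h2⟩ :=
      CayleyMoser.BiddingProcess.integral_salePrice_thresholdPolicy (B := B) hr hm hν₀ hm0 ht
    exact ⟨CayleyMoser.BiddingProcess.isPolicy_thresholdPolicy hm.monotone.measurable t, h1, h2,
      hgr t ht⟩
  · rw [CayleyMoser.priceRange_eq hν] at hx
    exact ⟨hx.2, CayleyMoser.intervalIntegrable_one_div hL hA ha hx.2⟩
  · rw [CayleyMoser.priceRange_eq hν]
    exact CayleyMoser.bijOn_recipPrimitive hL hA hlim ha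
  · rw [CayleyMoser.priceRange_eq hν, hopt t ht, CayleyMoser.threshold, CayleyMoser.flow,
      max_eq_left ht]
    rfl
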